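/- Let $f\colon\{0,1,2,\dots\}\to(0,\infty)$ be nondecreasing with $f(k)\le k+1$ for all $k\ge 0$. Consider the following growing random directed graph. At time $1$ it consists of the single vertex $1$ and has no edges. For each $n\ge 1$, given the graph at time $n$ (with vertices $1,\dots,n$), the vertex $n+1$ is added and, independently for each old vertex $m\in\{1,\dots,n\}$, a directed edge $n+1\to m$ is inserted with probability $\frac1n f(\mathcal Z[m,n])$, where $\mathcal Z[m,n]$ is the indegree of the vertex $m$ at time $n$. Let $$X_k(n)=\frac1n\sum_{i=1}^n \mathbf 1_{\{\mathcal Z[i,n]=k\}},\qquad X(n)=(X_k(n))_{k\ge 0},$$ be the empirical indegree distribution at time $n$, and let $$\mu_k=\frac1{1+f(k)}\prod_{l=0}^{k-1}\frac{f(l)}{1+f(l)},\qquad k\ge 0.$$ (i) $\mu=(\mu_k)_{k\ge 0}$ is a probability distribution on $\{0,1,2,\dots\}$, and, almost surely, $X(n)\to\mu$ in total variation norm as $n\to\infty$, that is, $\sum_{k\ge 0}|X_k(n)-\mu_k|\to 0$. (ii) If there is an $\eta\in(0,1)$ with $f(k)\le \eta k+1$ for all $k\ge 0$, then $\lambda:=\langle\mu,f\rangle=\sum_{k\ge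 0}\mu_k f(k)$ is finite and, almost surely, the conditional distribution of the outdegree of the vertex $n+1$, given the graph at time $n$, converges in total variation to the Poisson distribution with parameter $\lambda$ as $n\to\infty$. -/

import Mathlib

open MeasureTheory ProbabilityTheory Filter Topology
open scoped ENNReal NNReal

namespace PrefAttach

/-- A finite directed graph with labels in `ℕ`, given by its set of edges;
`(a, b) ∈ g` is a directed edge `a → b`. At time `n` the vertex set is `{1, …, n}`. -/
def Graph : Type := Finset (ℕ × ℕ)

/-- There are countably many finite graphs; they carry the discrete σ-algebra. -/
instance : MeasurableSpace Graph := ⊤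

/-- The graph on a given finite set of edges. -/
def Graph.ofEdges (s : Finset (ℕ × ℕ)) : Graph := s

/-- The finite set of edges of a graph. -/
def Graph.edges (g : Graph) : Finset (ℕ × ℕ) := g

/-- The indegree of the vertex `m`. -/
def Graph.indeg (g : Graph) (m : ℕ) : ℕ := (g.edges.filter fun e => e.2 = m).card

/-- The outdegree of the vertex `m`. -/
def Graph.outdeg (g : Graph) (m : ℕ) : ℕ := (g.edges.filter fun e => e.1 = m).card

/-- The graph obtained from `g` by inserting the edges `v → m` for all `m ∈ A`. -/
def Graph.attach (g : Graph) (v : ℕ) (A : Finset ℕ) : Graph :=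
  Graph.ofEdges (g.edges ∪ ({v} : Finset ℕ) ×ˢ A)

variable {Ω : Type*} [MeasurableSpace Ω]

/-- `G 1, G 2, …` is the preferential attachment network with attachment rule `f`, on a
probability space with measure `P`. At time `1` there is the single vertex `1` and no edge.
Given that the graph at time `n` is `g`, the vertex `n + 1` is added and is linked by an edge
`n + 1 → m` to each old vertex `m ∈ {1, …, n}` with probability `f (g.indeg m) / n`,
independently for the different old vertices: the set of old vertices that it is linked to is `A`
with conditional probability
`∏_{m ∈ A} f (g.indeg m) / n * ∏_{m ∉ A} (1 - f (g.indeg m) / n)`.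
All edges run from younger to older vertices, so the graph at time `n` determines all the earlier
ones, and conditioning on it is conditioning on the whole history up to time `n`. -/
structure IsNetwork (f : ℕ → ℝ) (P : Measure Ω) (G : ℕ → Ω → Graph) : Prop where
  measurable : ∀ n, 1 ≤ n → Measurable (G n)
  initial : ∀ᵐ ω ∂P, G 1 ω = Graph.ofEdges ∅
  step : ∀ n, 1 ≤ n → ∀ g : Graph, ∀ A ⊆ Finset.Icc 1 n,
    P {ω | G n ω = g ∧ G (n + 1) ω = g.attach (n + 1) A} =
      P {ω | G n ω = g} *
        ((∏ m ∈ A, ENNReal.ofReal (f (g.indeg m) / n)) *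
          ∏ m ∈ Finset.Icc 1 n \ A, ENNReal.ofReal (1 - f (g.indeg m) / n))

/-- The empirical indegree distribution: the proportion of vertices of `{1, …, n}` that have
indegree `k` in the graph `g`. -/
noncomputable def empirical (g : Graph) (n k : ℕ) : ℝ :=
  (1 / (n : ℝ)) * ∑ i ∈ Finset.Icc 1 n, if g.indeg i = k then (1 : ℝ) else 0

/-- The weights `μ_k = 1 / (1 + f k) * ∏_{l < k} f l / (1 + f l)`. -/
noncomputable def limitWeight (f : ℕ → ℝ) (k : ℕ) : ℝ :=
  1 / (1 + f k) * ∏ l ∈ Finset.range k, f l / (1 + f l)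

/-- The total variation norm of the signed measure on `ℕ` with weights `x k`. -/
noncomputable def tvNorm (x : ℕ → ℝ) : ℝ≥0∞ := ∑' k, ENNReal.ofReal |x k|

/-- The total variation distance of two (finite) measures on `ℕ`, that is, the total variation
norm of their difference. -/
noncomputable def tvDist (P Q : Measure ℕ) : ℝ≥0∞ := tvNorm fun k => P.real {k} - Q.real {k}

/-- The conditional distribution of the outdegree of the vertex `n + 1`, given the graph at
time `n`: a random probability measure on `ℕ`, a function of `ω` through `G n ω`. -/
noncomputable def condOutdeg (P : Measure Ω) [IsFiniteMeasure P] (G : ℕ → Ω → Graph) (n : ℕ)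
    (ω : Ω) : Measure ℕ :=
  condDistrib (fun ω' => (G (n + 1) ω').outdeg (n + 1)) (G n) P (G n ω)

end PrefAttach

/-!
The idea is stochastic approximation. For a function `φ` of the indegree with `φ 0 = 0` and
increments in `[0, 1]`, the sum `W n` of `φ` over the indegrees at time `n` increases, given the
present graph, by a linear function of the random set of vertices that the new vertex links to.
So `W (n + 1) - W n` is a drift (`degDrift`) plus a centred noise (`degNoise`) whose conditional
variance is at most the drift. If the expected drift is bounded, the partial sums of the noise
divided by the time form an `L²`-bounded martingale and converge almost surely
(`IsRegularNetwork.ae_tendsto_noiseSum`). The averages `W n / n` then follow a recursion with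
step sizes of order `1 / n` and a convergent series of perturbations, whose limit is read off
from its equilibrium (`eventually_le_of_recursion`).

* With `φ` the indicator of indegree at least `k + 1`, the drift is `f k * (x k - x (k + 1))`,
  where `x k` is the proportion of vertices of indegree at least `k`. Inductively, `x k` converges
  to `q k = ∏_{l < k} f l / (1 + f l)`, and `μ_k = q k - q (k + 1)`. Pointwise convergence of
  probability weights to probability weights is convergence in total variation, by Scheffé's lemma
  (`tendsto_tvNorm_of_tendsto`).
* With `φ` the excess of the indegree over `K` and `f k ≤ η k + 1`, the drift is at most `η` times
  the mean excess plus `(η K + 1) x K`. Hence the mean excess has upper limit at most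
  `(η K + 1) q K / (1 - η)`. Summation by parts shows that `∑ q k` is finite, so this bound tends
  to `0` as `K → ∞`. This uniform integrability gives the convergence of the mean of `f` over the
  indegrees to `λ = ∑ q (k + 1)`, and it shows that the largest link probability tends to `0`.
* Given the graph, the outdegree of the new vertex is a sum of independent indicators. The sum of
  the link probabilities tends to `λ` and the sum of their squares to `0`, so the weights of the
  outdegree converge to the Poisson weights. Size biasing replaces the Poisson recursion
  `(k + 1) π (k + 1) = λ π k` by an approximate one (`abs_succ_mul_bernCount_succ_sub_le`).

Almost surely the graph at a given time determines all the earlier ones. On a null set the network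
is replaced by the empty graph (`IsNetwork.exists_isRegularNetwork`), so that this holds for every
path and the graphs generate a filtration.
-/

namespace PrefAttach

/-! ### Random subsets with independent elements -/

/-- The expectation of `F A` when the random set `A ⊆ s` contains each `m ∈ s` independently with
probability `p m`. It is defined as a finite sum, for arbitrary real weights `p`. -/
def bernSum (s : Finset ℕ) (p : ℕ → ℝ) (F : Finset ℕ → ℝ) : ℝ :=
  ∑ A ∈ s.powerset, ((∏ m ∈ A, p m) * ∏ m ∈ s \ A, (1 - p m)) * F A

lemma bernSum_congr {s : Finset ℕ} {p : ℕ → ℝ} {F F' : Finset ℕ → ℝ}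
    (h : ∀ A ⊆ s, F A = F' A) : bernSum s p F = bernSum s p F' :=
  Finset.sum_congr rfl fun A hA => by rw [h A (Finset.mem_powerset.1 hA)]

lemma bernSum_insert {s : Finset ℕ} {a : ℕ} (ha : a ∉ s) (p : ℕ → ℝ) (F : Finset ℕ → ℝ) :
    bernSum (insert a s) p F =
      (1 - p a) * bernSum s p F + p a * bernSum s p (fun A => F (insert a A)) := by
  unfold bernSum
  rw [Finset.sum_powerset_insert ha, Finset.mul_sum, Finset.mul_sum]
  congr 1
  · refine Finset.sum_congr rfl fun A hA => ?_
    have haA : a ∉ A := fun h => ha (Finset.mem_powerset.1 hA h)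
    rw [Finset.insert_sdiff_of_notMem _ haA, Finset.prod_insert (by simp [ha])]
    ring
  · refine Finset.sum_congr rfl fun A hA => ?_
    have haA : a ∉ A := fun h => ha (Finset.mem_powerset.1 hA h)
    rw [Finset.prod_insert haA, Finset.insert_sdiff_insert, Finset.sdiff_insert_of_notMem ha]
    ring

lemma bernSum_add (s : Finset ℕ) (p : ℕ → ℝ) (F F' : Finset ℕ → ℝ) :
    bernSum s p (fun A => F A + F' A) = bernSum s p F + bernSum s p F' := by
  simp only [bernSum, mul_add, Finset.sum_add_distrib]

lemma bernSum_const_mul (s : Finset ℕ) (p : ℕ → ℝ) (c : ℝ) (F : Finset ℕ → ℝ) :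
    bernSum s p (fun A => c * F A) = c * bernSum s p F := by
  simp only [bernSum, Finset.mul_sum]
  exact Finset.sum_congr rfl fun A _ => by ring

lemma bernSum_finset_sum (s : Finset ℕ) (p : ℕ → ℝ) {ι : Type*} (t : Finset ι)
    (F : ι → Finset ℕ → ℝ) :
    bernSum s p (fun A => ∑ i ∈ t, F i A) = ∑ i ∈ t, bernSum s p (F i) := by
  simp only [bernSum, Finset.mul_sum]
  exact Finset.sum_comm

lemma bernSum_const (s : Finset ℕ) (p : ℕ → ℝ) (c : ℝ) : bernSum s p (fun _ => c) = c := by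
  induction s using Finset.induction_on with
  | empty => simp [bernSum]
  | insert a s ha ih => rw [bernSum_insert ha, ih]; ring

lemma bernSum_nonneg {s : Finset ℕ} {p : ℕ → ℝ} {F : Finset ℕ → ℝ}
    (hp : ∀ m ∈ s, 0 ≤ p m ∧ p m ≤ 1) (hF : ∀ A, 0 ≤ F A) : 0 ≤ bernSum s p F := by
  refine Finset.sum_nonneg fun A hA => mul_nonneg (mul_nonneg ?_ ?_) (hF A)
  · exact Finset.prod_nonneg fun m hm => (hp m (Finset.mem_powerset.1 hA hm)).1
  · exact Finset.prod_nonneg fun m hm => sub_nonneg.2 (hp m (Finset.mem_sdiff.1 hm).1).2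

lemma bernSum_mono {s : Finset ℕ} {p : ℕ → ℝ} {F F' : Finset ℕ → ℝ}
    (hp : ∀ m ∈ s, 0 ≤ p m ∧ p m ≤ 1) (hF : ∀ A, F A ≤ F' A) :
    bernSum s p F ≤ bernSum s p F' := by
  have := bernSum_nonneg hp (F := fun A => F' A + (-1) * F A) fun A => by linarith [hF A]
  rw [bernSum_add, bernSum_const_mul] at this
  linarith

lemma bernSum_sum_add (s : Finset ℕ) (p c : ℕ → ℝ) (t : ℝ) :
    bernSum s p (fun A => ∑ m ∈ A, c m + t) = ∑ m ∈ s, c m * p m + t := by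
  induction s using Finset.induction_on generalizing t with
  | empty => simp [bernSum]
  | insert a s ha ih =>
    rw [bernSum_insert ha, ih,
      bernSum_congr (F' := fun A => ∑ m ∈ A, c m + (c a + t)), ih, Finset.sum_insert ha]
    · ring
    · intro A hA
      rw [Finset.sum_insert fun h => ha (hA h)]
      ring

lemma bernSum_sum_add_sq (s : Finset ℕ) (p c : ℕ → ℝ) (t : ℝ) :
    bernSum s p (fun A => (∑ m ∈ A, c m + t) ^ 2) =
      ∑ m ∈ s, c m ^ 2 * (p m * (1 - p m)) + (∑ m ∈ s, c m * p m + t) ^ 2 := by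
  induction s using Finset.induction_on generalizing t with
  | empty => simp [bernSum]
  | insert a s ha ih =>
    rw [bernSum_insert ha, ih,
      bernSum_congr (F' := fun A => (∑ m ∈ A, c m + (c a + t)) ^ 2), ih,
      Finset.sum_insert ha, Finset.sum_insert ha]
    · ring
    · intro A hA
      rw [Finset.sum_insert fun h => ha (hA h)]
      ring

/-! ### The Poisson limit of the size of a random subset -/

/-- The probability that the random subset has exactly `k` elements. -/
def bernCount (s : Finset ℕ) (p : ℕ → ℝ) (k : ℕ) : ℝ :=
  bernSum s p (fun A => if A.card = k then 1 else 0)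

lemma bernCount_nonneg {s : Finset ℕ} {p : ℕ → ℝ} (hp : ∀ m ∈ s, 0 ≤ p m ∧ p m ≤ 1) (k : ℕ) :
    0 ≤ bernCount s p k :=
  bernSum_nonneg hp fun A => by split_ifs <;> norm_num

lemma bernCount_le_one {s : Finset ℕ} {p : ℕ → ℝ} (hp : ∀ m ∈ s, 0 ≤ p m ∧ p m ≤ 1) (k : ℕ) :
    bernCount s p k ≤ 1 := by
  rw [← bernSum_const s p 1]
  exact bernSum_mono hp fun A => by split_ifs <;> norm_num

lemma hasSum_bernCount (s : Finset ℕ) (p : ℕ → ℝ) : HasSum (bernCount s p) 1 := by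
  have h : ∑ k ∈ Finset.range (s.card + 1), bernCount s p k = 1 := by
    unfold bernCount
    rw [← bernSum_finset_sum]
    refine (bernSum_congr fun A hA => ?_).trans (bernSum_const s p 1)
    have := Finset.card_le_card hA
    rw [Finset.sum_ite_eq, if_pos (Finset.mem_range.2 (by omega))]
  rw [← h]
  refine hasSum_sum_of_ne_finset_zero fun k hk => ?_
  refine (bernSum_congr fun A hA => if_neg ?_).trans (bernSum_const s p 0)
  have := Finset.card_le_card hA
  rw [Finset.mem_range] at hk
  omega

lemma bernCount_zero (s : Finset ℕ) (p : ℕ → ℝ) : bernCount s p 0 = ∏ m ∈ s, (1 - p m) := by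
  unfold bernCount bernSum
  rw [Finset.sum_eq_single ∅]
  · simp
  · intro A _ hA
    simp [hA]
  · simp

lemma bernSum_indicator_mem {s : Finset ℕ} {m : ℕ} (hm : m ∈ s) (p : ℕ → ℝ) (k : ℕ) :
    bernSum s p (fun A => if m ∈ A ∧ A.card = k + 1 then 1 else 0) =
      p m * bernCount (s.erase m) p k := by
  conv_lhs => rw [← Finset.insert_erase hm]
  rw [bernSum_insert (Finset.notMem_erase m s),
    bernSum_congr (F' := fun _ => 0) (F := fun A => if m ∈ A ∧ A.card = k + 1 then (1 : ℝ) else 0),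
    bernSum_const]
  · rw [mul_zero, zero_add, bernCount]
    congr 1
    refine bernSum_congr fun A hA => ?_
    have : m ∉ A := fun h => Finset.notMem_erase m s (hA h)
    simp [Finset.card_insert_of_notMem this]
  · intro A hA
    have : m ∉ A := fun h => Finset.notMem_erase m s (hA h)
    simp [this]

/-- The size-bias identity: `E[|A|; |A| = k + 1]` is computed by summing over the elements
of `A`. -/
lemma succ_mul_bernCount_succ (s : Finset ℕ) (p : ℕ → ℝ) (k : ℕ) :
    ((k : ℝ) + 1) * bernCount s p (k + 1) = ∑ m ∈ s, p m * bernCount (s.erase m) p k := by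
  rw [← Finset.sum_congr rfl fun m hm => bernSum_indicator_mem hm p k, ← bernSum_finset_sum,
    bernCount, ← bernSum_const_mul]
  refine bernSum_congr fun A hA => ?_
  by_cases hc : A.card = k + 1
  · have : ∑ m ∈ s, (if m ∈ A then (1 : ℝ) else 0) = A.card := by
      rw [← Finset.sum_filter, Finset.filter_mem_eq_inter, Finset.inter_eq_right.2 hA]
      simp
    simp [hc, this]
  · simp [hc]

lemma abs_bernCount_erase_sub_le {s : Finset ℕ} {p : ℕ → ℝ}
    (hp : ∀ m ∈ s, 0 ≤ p m ∧ p m ≤ 1) {m : ℕ} (hm : m ∈ s) (k : ℕ) :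
    |bernCount (s.erase m) p k - bernCount s p k| ≤ p m := by
  have hp' : ∀ i ∈ s.erase m, 0 ≤ p i ∧ p i ≤ 1 := fun i hi => hp i (Finset.mem_of_mem_erase hi)
  set B := bernSum (s.erase m) p (fun A => if (insert m A).card = k then 1 else 0) with hB
  have h : bernCount s p k = (1 - p m) * bernCount (s.erase m) p k + p m * B := by
    unfold bernCount
    conv_lhs => rw [← Finset.insert_erase hm]
    rw [bernSum_insert (Finset.notMem_erase m s)]
  have hB0 : 0 ≤ B := bernSum_nonneg hp' fun A => by split_ifs <;> norm_num
  have hB1 : B ≤ 1 := by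
    rw [← bernSum_const (s.erase m) p 1]
    exact bernSum_mono hp' fun A => by split_ifs <;> norm_num
  have h0 := bernCount_nonneg hp' k
  have h1 := bernCount_le_one hp' k
  have h2 := (hp m hm).1
  have h3 : bernCount (s.erase m) p k - bernCount s p k =
      p m * (bernCount (s.erase m) p k - B) := by rw [h]; ring
  rw [h3, abs_mul, abs_of_nonneg h2]
  exact mul_le_of_le_one_right h2 (abs_le.2 ⟨by linarith, by linarith⟩)

/-- An approximate form of the recursion `(k + 1) π (k + 1) = λ π k` of the Poisson weights. -/
lemma abs_succ_mul_bernCount_succ_sub_le {s : Finset ℕ} {p : ℕ → ℝ}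
    (hp : ∀ m ∈ s, 0 ≤ p m ∧ p m ≤ 1) (k : ℕ) :
    |((k : ℝ) + 1) * bernCount s p (k + 1) - (∑ m ∈ s, p m) * bernCount s p k| ≤
      ∑ m ∈ s, p m ^ 2 := by
  rw [succ_mul_bernCount_succ, Finset.sum_mul, ← Finset.sum_sub_distrib]
  refine (Finset.abs_sum_le_sum_abs _ _).trans (Finset.sum_le_sum fun m hm => ?_)
  rw [← mul_sub, abs_mul, abs_of_nonneg (hp m hm).1, sq]
  exact mul_le_mul_of_nonneg_left (abs_bernCount_erase_sub_le hp hm k) (hp m hm).1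

lemma abs_prod_one_sub_sub_exp_le {s : Finset ℕ} {p : ℕ → ℝ}
    (hp : ∀ m ∈ s, 0 ≤ p m ∧ p m ≤ 1) :
    |∏ m ∈ s, (1 - p m) - Real.exp (-∑ m ∈ s, p m)| ≤ ∑ m ∈ s, p m ^ 2 := by
  induction s using Finset.induction_on with
  | empty => simp
  | insert a s ha ih =>
    have ih' := ih fun m hm => hp m (Finset.mem_insert_of_mem hm)
    obtain ⟨ha0, ha1⟩ := hp a (Finset.mem_insert_self a s)
    rw [Finset.prod_insert ha, Finset.sum_insert ha, Finset.sum_insert ha, neg_add, Real.exp_add]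
    set E := Real.exp (-∑ m ∈ s, p m) with hE
    set Q := ∏ m ∈ s, (1 - p m)
    have hE0 : 0 ≤ E := (Real.exp_pos _).le
    have hE1 : E ≤ 1 := Real.exp_le_one_iff.2 <| neg_nonpos.2 <|
      Finset.sum_nonneg fun m hm => (hp m (Finset.mem_insert_of_mem hm)).1
    have h1 : |Real.exp (-p a) - 1 - -p a| ≤ (-p a) ^ 2 :=
      Real.abs_exp_sub_one_sub_id_le (by rw [abs_neg, abs_of_nonneg ha0]; exact ha1)
    have h2 : (1 - p a) * Q - Real.exp (-p a) * E =
        (1 - p a) * (Q - E) - (Real.exp (-p a) - 1 - -p a) * E := by ring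
    rw [h2]
    refine (abs_sub _ _).trans ?_
    rw [abs_mul, abs_mul, abs_of_nonneg hE0, abs_of_nonneg (sub_nonneg.2 ha1), add_comm]
    refine add_le_add ?_ ?_
    · calc _ ≤ (-p a) ^ 2 * 1 := mul_le_mul h1 hE1 hE0 (sq_nonneg _)
        _ = p a ^ 2 := by ring
    · exact (mul_le_of_le_one_left (abs_nonneg _) (by linarith)).trans ih'

/-- Poisson convergence of sums of independent indicators, for each single weight. -/
lemma tendsto_bernCount {s : ℕ → Finset ℕ} {p : ℕ → ℕ → ℝ} {r : ℝ}
    (hp : ∀ᶠ n in atTop, ∀ m ∈ s n, 0 ≤ p n m ∧ p n m ≤ 1)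
    (hsum : Tendsto (fun n => ∑ m ∈ s n, p n m) atTop (𝓝 r))
    (hsq : Tendsto (fun n => ∑ m ∈ s n, p n m ^ 2) atTop (𝓝 0)) (k : ℕ) :
    Tendsto (fun n => bernCount (s n) (p n) k) atTop
      (𝓝 (Real.exp (-r) * r ^ k / (k.factorial : ℝ))) := by
  induction k with
  | zero =>
    simp only [bernCount_zero, pow_zero, Nat.factorial_zero, Nat.cast_one, mul_one, div_one]
    have h1 : Tendsto (fun n => ∏ m ∈ s n, (1 - p n m) - Real.exp (-∑ m ∈ s n, p n m))
        atTop (𝓝 0) :=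
      squeeze_zero_norm' (hp.mono fun n hn => abs_prod_one_sub_sub_exp_le hn) hsq
    have h2 := h1.add ((Real.continuous_exp.tendsto _).comp hsum.neg)
    simpa using h2
  | succ k ih =>
    have h1 : Tendsto (fun n => ((k : ℝ) + 1) * bernCount (s n) (p n) (k + 1) -
        (∑ m ∈ s n, p n m) * bernCount (s n) (p n) k) atTop (𝓝 0) :=
      squeeze_zero_norm' (hp.mono fun n hn => abs_succ_mul_bernCount_succ_sub_le hn k) hsq
    have h2 := (h1.add (hsum.mul ih)).const_mul ((k : ℝ) + 1)⁻¹
    have hk : (k : ℝ) + 1 ≠ 0 := by positivity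
    have hk' : (k.factorial : ℝ) ≠ 0 := by positivity
    refine (h2.congr fun n => ?_).trans_eq ?_
    · field_simp
      ring
    · congr 1
      rw [Nat.factorial_succ, Nat.cast_mul, Nat.cast_succ, zero_add]
      field_simp
      ring

/-! ### A perturbed linear recursion -/

/-- The deterministic half of the stochastic approximation argument: a sequence that is pulled
towards `a n / c` with the non-summable step sizes `1 / (n + 2)` and is perturbed by a convergent
series satisfies `limsup x ≤ limsup a / c`. -/
lemma eventually_le_of_recursion {x a e : ℕ → ℝ} {c α : ℝ} (hc : 0 < c)
    (hstep : ∀ n, x (n + 1) ≤ x n + (a n - c * x n) / ((n : ℝ) + 2) + e n)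
    (he : ∃ l, Tendsto (fun n => ∑ j ∈ Finset.range n, e j) atTop (𝓝 l))
    (ha : ∀ δ > 0, ∀ᶠ n in atTop, a n ≤ α + δ) {δ : ℝ} (hδ : 0 < δ) :
    ∀ᶠ n in atTop, x n ≤ α / c + δ := by
  obtain ⟨l, hl⟩ := he
  set t : ℕ → ℝ := fun n => ∑ j ∈ Finset.range n, e j - l with ht
  have ht0 : Tendsto t atTop (𝓝 0) := by simpa [ht] using hl.sub_const l
  have htabs : ∀ ε > 0, ∀ᶠ n in atTop, |t n| < ε := fun ε hε => by
    simpa [Real.dist_eq] using (Metric.tendsto_nhds.1 ht0) ε hε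
  -- After subtracting the noise that has already been received, `z` obeys a noiseless recursion.
  set z : ℕ → ℝ := fun n => x n - t n - (α / c + δ / 2) with hz
  have hzstep : ∀ᶠ n : ℕ in atTop, z (n + 1) ≤ z n * (1 - c / ((n : ℝ) + 2)) := by
    filter_upwards [ha (c * δ / 4) (by positivity), htabs (δ / 4) (by positivity)] with n han htn
    have h1 : t (n + 1) = t n + e n := by simp only [ht, Finset.sum_range_succ]; ring
    have h2 : 0 < (n : ℝ) + 2 := by positivity
    have h3 : a n - c * x n ≤ - c * z n := by
      have h4 : -(c * t n) ≤ c * (δ / 4) := by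
        rw [← mul_neg]
        exact mul_le_mul_of_nonneg_left (by linarith [neg_abs_le (t n)]) hc.le
      have h5 : c * (α / c) = α := by field_simp
      have h6 : - c * z n = - c * x n + c * t n + (c * (α / c)) + c * δ / 2 := by
        simp only [hz]; ring
      rw [h6, h5]
      linarith
    have h7 := hstep n
    have h8 : (a n - c * x n) / ((n : ℝ) + 2) ≤ (- c * z n) / ((n : ℝ) + 2) := by gcongr
    have h9 : z n * (1 - c / ((n : ℝ) + 2)) = z n + (- c * z n) / ((n : ℝ) + 2) := by
      field_simp
      ring
    rw [h9]
    simp only [hz, h1] at h8 ⊢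
    linarith
  set h : ℕ → ℝ := fun n => ∑ i ∈ Finset.range (n + 1), 1 / ((i : ℝ) + 1) with hh
  have hhtop : Tendsto h atTop atTop :=
    Real.tendsto_sum_range_one_div_nat_succ_atTop.comp (tendsto_add_atTop_nat 1)
  have hlarge : ∀ᶠ n : ℕ in atTop, c ≤ (n : ℝ) + 2 := by
    filter_upwards [tendsto_natCast_atTop_atTop.eventually_ge_atTop c] with n hn
    linarith
  obtain ⟨N, hN⟩ := eventually_atTop.1 (hzstep.and hlarge)
  -- The positive part of `z`, multiplied by `exp (c * h n)`, does not increase.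
  have hu : ∀ n ≥ N, max (z n) 0 * Real.exp (c * h n) ≤ max (z N) 0 * Real.exp (c * h N) := by
    intro n hn
    induction n, hn using Nat.le_induction with
    | base => exact le_rfl
    | succ n hn ih =>
      obtain ⟨h1, h2⟩ := hN n hn
      refine le_trans ?_ ih
      have hpos : 0 < (n : ℝ) + 2 := by positivity
      have h3 : 0 ≤ 1 - c / ((n : ℝ) + 2) := sub_nonneg.2 ((div_le_one hpos).2 h2)
      have h4 : max (z (n + 1)) 0 ≤ max (z n) 0 * (1 - c / ((n : ℝ) + 2)) :=
        max_le (h1.trans (mul_le_mul_of_nonneg_right (le_max_left _ _) h3))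
          (mul_nonneg (le_max_right _ _) h3)
      have h5 : h (n + 1) = h n + 1 / ((n : ℝ) + 2) := by
        simp only [hh]
        rw [Finset.sum_range_succ]
        push_cast
        ring
      have h6 : 1 - c / ((n : ℝ) + 2) ≤ Real.exp (-(c / ((n : ℝ) + 2))) := by
        linarith [Real.add_one_le_exp (-(c / ((n : ℝ) + 2)))]
      calc max (z (n + 1)) 0 * Real.exp (c * h (n + 1))
          ≤ max (z n) 0 * Real.exp (-(c / ((n : ℝ) + 2))) * Real.exp (c * h (n + 1)) := by
            gcongr
            exact h4.trans (mul_le_mul_of_nonneg_left h6 (le_max_right _ _))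
        _ = max (z n) 0 * Real.exp (c * h n) := by
            rw [mul_assoc, ← Real.exp_add, h5]
            congr 2
            ring
  have hz0 : Tendsto (fun n => max (z N) 0 * Real.exp (c * h N) * Real.exp (-(c * h n)))
      atTop (𝓝 0) := by
    have := (Real.tendsto_exp_neg_atTop_nhds_zero.comp (hhtop.const_mul_atTop hc)).const_mul
      (max (z N) 0 * Real.exp (c * h N))
    simpa using this
  filter_upwards [hz0.eventually_lt_const (show (0 : ℝ) < δ / 4 by positivity),
    htabs (δ / 4) (by positivity), eventually_ge_atTop N] with n h1 h2 h3
  have h4 : z n ≤ max (z N) 0 * Real.exp (c * h N) * Real.exp (-(c * h n)) := by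
    refine (le_max_left _ 0).trans ?_
    rw [Real.exp_neg, ← div_eq_mul_inv, le_div_iff₀ (Real.exp_pos _)]
    exact hu n h3
  have h5 : x n = z n + t n + (α / c + δ / 2) := by simp only [hz]; ring
  linarith [le_abs_self (t n)]

lemma tendsto_of_recursion {x a e : ℕ → ℝ} {c α : ℝ} (hc : 0 < c)
    (hstep : ∀ n, x (n + 1) = x n + (a n - c * x n) / ((n : ℝ) + 2) + e n)
    (he : ∃ l, Tendsto (fun n => ∑ j ∈ Finset.range n, e j) atTop (𝓝 l))
    (ha : Tendsto a atTop (𝓝 α)) : Tendsto x atTop (𝓝 (α / c)) := by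
  rw [Metric.tendsto_nhds]
  intro ε hε
  have ha' := Metric.tendsto_nhds.1 ha
  have h1 := eventually_le_of_recursion (α := α) hc (fun n => (hstep n).le) he
    (fun δ hδ => (ha' δ hδ).mono fun n hn => by
      rw [Real.dist_eq] at hn
      linarith [le_abs_self (a n - α)]) (half_pos hε)
  have h2 := eventually_le_of_recursion (x := fun n => - x n) (a := fun n => - a n)
    (e := fun n => - e n) (α := -α) hc (fun n => by rw [hstep n]; apply le_of_eq; ring)
    (by
      obtain ⟨l, hl⟩ := he
      exact ⟨-l, by simpa using hl.neg⟩)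
    (fun δ hδ => (ha' δ hδ).mono fun n hn => by
      rw [Real.dist_eq] at hn
      linarith [neg_abs_le (a n - α)]) (half_pos hε)
  filter_upwards [h1, h2] with n h1 h2
  rw [neg_div] at h2
  rw [Real.dist_eq, abs_lt]
  constructor <;> linarith

/-! ### Pointwise convergence of probability weights implies convergence in total variation -/

lemma tvNorm_eq_ofReal {x : ℕ → ℝ} (hx : Summable x) : tvNorm x = ENNReal.ofReal (∑' k, |x k|) :=
  (ENNReal.ofReal_tsum_of_nonneg (fun k => abs_nonneg (x k)) hx.abs).symm

/-- Scheffé's lemma for weights on `ℕ`. -/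
lemma tendsto_tvNorm_of_tendsto {a : ℕ → ℕ → ℝ} {μ : ℕ → ℝ}
    (ha0 : ∀ᶠ n in atTop, ∀ k, 0 ≤ a n k) (ha1 : ∀ᶠ n in atTop, HasSum (a n) 1)
    (hμ : HasSum μ 1) (hlim : ∀ k, Tendsto (fun n => a n k) atTop (𝓝 (μ k))) :
    Tendsto (fun n => tvNorm fun k => a n k - μ k) atTop (𝓝 0) := by
  have h1 : Tendsto (fun n => ∑' k, max (μ k - a n k) 0) atTop (𝓝 (∑' _ : ℕ, (0 : ℝ))) := by
    refine tendsto_tsum_of_dominated_convergence (bound := fun k => |μ k|) hμ.summable.abs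
      (fun k => ?_) ?_
    · have := ((tendsto_const_nhds (x := μ k)).sub (hlim k)).max (tendsto_const_nhds (x := (0 : ℝ)))
      simpa using this
    · filter_upwards [ha0] with n hn k
      rw [Real.norm_eq_abs, abs_of_nonneg (le_max_right _ _)]
      exact max_le (by linarith [hn k, le_abs_self (μ k)]) (abs_nonneg _)
  rw [tsum_zero] at h1
  have h2 := ENNReal.tendsto_ofReal (h1.const_mul 2)
  rw [mul_zero, ENNReal.ofReal_zero] at h2
  refine h2.congr' ?_
  filter_upwards [ha0, ha1] with n hn0 hn1
  have hd : HasSum (fun k => a n k - μ k) 0 := by simpa using hn1.sub hμ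
  rw [tvNorm_eq_ofReal hd.summable]
  congr 1
  have hm : Summable fun k => max (μ k - a n k) 0 := by
    refine Summable.of_nonneg_of_le (fun k => le_max_right _ _) (fun k => ?_) hμ.summable.abs
    exact max_le (by linarith [hn0 k, le_abs_self (μ k)]) (abs_nonneg _)
  have h3 : ∀ k, |a n k - μ k| = 2 * max (μ k - a n k) 0 + (a n k - μ k) := fun k => by
    rcases le_total (a n k) (μ k) with h | h
    · rw [abs_of_nonpos (by linarith), max_eq_left (by linarith)]; ring
    · rw [abs_of_nonneg (by linarith), max_eq_right (by linarith)]; ring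
  rw [tsum_congr h3, (hm.mul_left 2).tsum_add hd.summable, hd.tsum_eq, tsum_mul_left, add_zero]

/-! ### The limiting weights -/

/-- The tail `q k = ∑_{j ≥ k} μ_j` of the limiting distribution, in closed form. -/
noncomputable def limitTail (f : ℕ → ℝ) (k : ℕ) : ℝ := ∏ l ∈ Finset.range k, f l / (1 + f l)

lemma limitTail_zero (f : ℕ → ℝ) : limitTail f 0 = 1 := by simp [limitTail]

lemma limitTail_succ (f : ℕ → ℝ) (k : ℕ) :
    limitTail f (k + 1) = limitTail f k * (f k / (1 + f k)) := Finset.prod_range_succ _ _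

lemma limitTail_pos {f : ℕ → ℝ} (hf : ∀ k, 0 < f k) (k : ℕ) : 0 < limitTail f k :=
  Finset.prod_pos fun l _ => div_pos (hf l) (by linarith [hf l])

lemma limitWeight_eq_sub {f : ℕ → ℝ} (hf : ∀ k, 0 < f k) (k : ℕ) :
    limitWeight f k = limitTail f k - limitTail f (k + 1) := by
  have : 1 + f k ≠ 0 := by linarith [hf k]
  rw [limitTail_succ, limitWeight, limitTail]
  field_simp
  ring

lemma limitWeight_mul {f : ℕ → ℝ} (k : ℕ) : limitWeight f k * f k = limitTail f (k + 1) := by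
  rw [limitTail_succ, limitWeight, limitTail]
  ring

lemma limitWeight_nonneg {f : ℕ → ℝ} (hf : ∀ k, 0 < f k) (k : ℕ) : 0 ≤ limitWeight f k :=
  nonneg_of_mul_nonneg_left ((limitWeight_mul k).symm ▸ (limitTail_pos hf _).le) (hf k)

lemma limitTail_succ_le {f : ℕ → ℝ} (hf : ∀ k, 0 < f k) {k : ℕ} {b : ℝ} (hb : f k ≤ b) :
    (1 + b) * limitTail f (k + 1) ≤ b * limitTail f k := by
  have h1 := limitWeight_eq_sub hf k
  have h2 := limitWeight_mul (f := f) k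
  have h3 := mul_le_mul_of_nonneg_left hb (limitWeight_nonneg hf k)
  rw [h2, h1] at h3
  linarith

lemma limitTail_antitone {f : ℕ → ℝ} (hf : ∀ k, 0 < f k) : Antitone (limitTail f) :=
  antitone_nat_of_succ_le fun k => by
    linarith [limitWeight_eq_sub hf k, limitWeight_nonneg hf k]

lemma limitTail_le {f : ℕ → ℝ} (hf : ∀ k, 0 < f k) (hle : ∀ k : ℕ, f k ≤ (k : ℝ) + 1) (k : ℕ) :
    limitTail f k ≤ 1 / ((k : ℝ) + 1) := by
  induction k with
  | zero => simp [limitTail_zero]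
  | succ k ih =>
    have h := limitTail_succ_le hf (hle k)
    rw [le_div_iff₀ (by positivity)] at ih ⊢
    push_cast
    linarith

lemma tendsto_limitTail {f : ℕ → ℝ} (hf : ∀ k, 0 < f k) (hle : ∀ k : ℕ, f k ≤ (k : ℝ) + 1) :
    Tendsto (limitTail f) atTop (𝓝 0) :=
  squeeze_zero (fun k => (limitTail_pos hf k).le) (limitTail_le hf hle)
    tendsto_one_div_add_atTop_nhds_zero_nat

lemma hasSum_limitWeight {f : ℕ → ℝ} (hf : ∀ k, 0 < f k) (hle : ∀ k : ℕ, f k ≤ (k : ℝ) + 1) :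
    HasSum (limitWeight f) 1 := by
  rw [hasSum_iff_tendsto_nat_of_nonneg (limitWeight_nonneg hf)]
  have h : ∀ n, ∑ k ∈ Finset.range n, limitWeight f k = 1 - limitTail f n := fun n => by
    rw [Finset.sum_congr rfl fun k _ => limitWeight_eq_sub hf k, Finset.sum_range_sub',
      limitTail_zero]
  simpa [h] using (tendsto_limitTail hf hle).const_sub 1

/-- Summation by parts gives `(1 - η) ∑_{k < n} q (k + 1) ≤ 1 - (η n + 1) q n`. -/
lemma sum_limitTail_le {f : ℕ → ℝ} (hf : ∀ k, 0 < f k) {η : ℝ}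
    (hle : ∀ k : ℕ, f k ≤ η * (k : ℝ) + 1) (n : ℕ) :
    (1 - η) * ∑ k ∈ Finset.range n, limitTail f (k + 1) ≤ 1 - (η * n + 1) * limitTail f n := by
  induction n with
  | zero => simp [limitTail_zero]
  | succ n ih =>
    have h := limitTail_succ_le hf (hle n)
    rw [Finset.sum_range_succ]
    push_cast
    linarith

lemma summable_limitTail {f : ℕ → ℝ} (hf : ∀ k, 0 < f k) {η : ℝ} (h0 : 0 < η) (h1 : η < 1)
    (hle : ∀ k : ℕ, f k ≤ η * (k : ℝ) + 1) : Summable fun k => limitTail f (k + 1) := by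
  refine summable_of_sum_range_le (c := 1 / (1 - η)) (fun k => (limitTail_pos hf _).le) fun n => ?_
  rw [le_div_iff₀' (by linarith)]
  have := limitTail_pos hf n
  exact (sum_limitTail_le hf hle n).trans (sub_le_self _ (by positivity))

/-- The terms of a convergent series of nonnegative antitone terms are `o (1 / n)`. -/
lemma tendsto_natCast_mul_of_summable {q : ℕ → ℝ} (hq : Antitone q) (h0 : ∀ n, 0 ≤ q n)
    (hs : Summable q) : Tendsto (fun n : ℕ => (n : ℝ) * q n) atTop (𝓝 0) := by
  have hsum := hs.hasSum.tendsto_sum_nat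
  have hhalf : Tendsto (fun n : ℕ => n / 2) atTop atTop := Nat.tendsto_div_const_atTop two_ne_zero
  have h1 := (hsum.sub (hsum.comp hhalf)).const_mul 2
  rw [sub_self, mul_zero] at h1
  refine squeeze_zero (fun n => mul_nonneg n.cast_nonneg (h0 n)) (fun n => ?_) h1
  have h2 : n / 2 ≤ n := Nat.div_le_self _ _
  rw [Function.comp_apply, ← Finset.sum_Ico_eq_sub _ h2]
  have h3 : ((n - n / 2 : ℕ) : ℝ) * q n ≤ ∑ k ∈ Finset.Ico (n / 2) n, q k := by
    rw [← nsmul_eq_mul, ← Nat.card_Ico]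
    exact Finset.card_nsmul_le_sum _ _ _ fun k hk => hq (Finset.mem_Ico.1 hk).2.le
  have h4 : (n : ℝ) ≤ 2 * ((n - n / 2 : ℕ) : ℝ) := by
    exact_mod_cast (by omega : n ≤ 2 * (n - n / 2))
  nlinarith [h0 n]

lemma tendsto_mul_limitTail {f : ℕ → ℝ} (hf : ∀ k, 0 < f k) {η : ℝ} (h0 : 0 < η) (h1 : η < 1)
    (hle : ∀ k : ℕ, f k ≤ η * (k : ℝ) + 1) :
    Tendsto (fun k : ℕ => (η * (k : ℝ) + 1) * limitTail f k) atTop (𝓝 0) := by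
  have hs : Summable (limitTail f) := (summable_nat_add_iff 1).1 (summable_limitTail hf h0 h1 hle)
  have h2 := ((tendsto_natCast_mul_of_summable (limitTail_antitone hf)
    (fun k => (limitTail_pos hf k).le) hs).const_mul η).add hs.tendsto_atTop_zero
  rw [mul_zero, zero_add] at h2
  exact h2.congr fun k => by ring

/-! ### Recursive graphs and their statistics -/

instance : DiscreteMeasurableSpace Graph := ⟨fun _ => trivial⟩

instance : Countable Graph := inferInstanceAs (Countable (Finset (ℕ × ℕ)))

/-- The graph has vertices in `{1, …, n}` and its edges run from younger to older vertices. -/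
def Graph.IsRecursive (g : Graph) (n : ℕ) : Prop :=
  ∀ e ∈ g.edges, 1 ≤ e.2 ∧ e.2 < e.1 ∧ e.1 ≤ n

lemma Graph.edges_attach (g : Graph) (v : ℕ) (A : Finset ℕ) :
    (g.attach v A).edges = g.edges ∪ ({v} : Finset ℕ) ×ˢ A := rfl

lemma Graph.IsRecursive.attach {g : Graph} {n : ℕ} (hg : g.IsRecursive n) {A : Finset ℕ}
    (hA : A ⊆ Finset.Icc 1 n) : (g.attach (n + 1) A).IsRecursive (n + 1) := by
  intro e he
  rw [edges_attach, Finset.mem_union, Finset.mem_product, Finset.mem_singleton] at he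
  rcases he with he | ⟨h1, h2⟩
  · obtain ⟨h1, h2, h3⟩ := hg e he
    exact ⟨h1, h2, by omega⟩
  · have := Finset.mem_Icc.1 (hA h2)
    omega

lemma Graph.IsRecursive.notMem_edges {g : Graph} {n : ℕ} (hg : g.IsRecursive n) (m : ℕ) :
    (n + 1, m) ∉ g.edges := fun h => by
  have := (hg _ h).2.2
  simp at this

lemma Graph.IsRecursive.indeg_attach {g : Graph} {n : ℕ} (hg : g.IsRecursive n) (A : Finset ℕ)
    (m : ℕ) : (g.attach (n + 1) A).indeg m = g.indeg m + if m ∈ A then 1 else 0 := by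
  unfold Graph.indeg
  rw [edges_attach, Finset.filter_union, Finset.card_union_of_disjoint]
  · congr 1
    split_ifs with h
    · rw [Finset.card_eq_one]
      refine ⟨(n + 1, m), ?_⟩
      ext ⟨a, b⟩
      simp only [Finset.mem_filter, Finset.mem_product, Finset.mem_singleton, Prod.mk.injEq]
      constructor
      · rintro ⟨⟨h1, -⟩, h3⟩
        exact ⟨h1, h3⟩
      · rintro ⟨rfl, rfl⟩
        exact ⟨⟨rfl, h⟩, rfl⟩
    · rw [Finset.card_eq_zero, Finset.filter_eq_empty_iff]
      rintro ⟨a, b⟩ hab rfl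
      exact h (Finset.mem_product.1 hab).2
  · refine Finset.disjoint_left.2 fun e h1 h2 => ?_
    have h3 := (Finset.mem_product.1 (Finset.mem_filter.1 h2).1).1
    rw [Finset.mem_singleton] at h3
    have := (hg e (Finset.mem_filter.1 h1).1).2.2
    omega

lemma Graph.IsRecursive.indeg_succ_eq_zero {g : Graph} {n : ℕ} (hg : g.IsRecursive n) :
    g.indeg (n + 1) = 0 := by
  unfold Graph.indeg
  rw [Finset.card_eq_zero, Finset.filter_eq_empty_iff]
  intro e he h
  have := hg e he
  omega

lemma Graph.IsRecursive.outdeg_attach {g : Graph} {n : ℕ} (hg : g.IsRecursive n)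
    (A : Finset ℕ) : (g.attach (n + 1) A).outdeg (n + 1) = A.card := by
  have h1 : g.edges.filter (fun e => e.1 = n + 1) = ∅ := by
    rw [Finset.filter_eq_empty_iff]
    intro e he h
    have := hg e he
    omega
  have h2 : (({n + 1} : Finset ℕ) ×ˢ A).filter (fun e => e.1 = n + 1) = {n + 1} ×ˢ A :=
    Finset.filter_true_of_mem fun e he => Finset.mem_singleton.1 (Finset.mem_product.1 he).1
  unfold Graph.outdeg
  rw [edges_attach, Finset.filter_union, h1, h2, Finset.empty_union, Finset.card_product]
  simp

lemma Graph.IsRecursive.attach_injective {g : Graph} {n : ℕ} (hg : g.IsRecursive n) :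
    Function.Injective (g.attach (n + 1)) := by
  have key : ∀ A m, m ∈ A ↔ (n + 1, m) ∈ (g.attach (n + 1) A).edges := fun A m => by
    rw [edges_attach, Finset.mem_union, Finset.mem_product]
    simp [hg.notMem_edges m]
  intro A B hAB
  ext m
  rw [key A, key B, hAB]

/-- The subgraph of the edges that start in `{1, …, n}`. -/
def Graph.restrict (g : Graph) (n : ℕ) : Graph := Graph.ofEdges (g.edges.filter fun e => e.1 ≤ n)

lemma Graph.restrict_restrict (g : Graph) {j n : ℕ} (hjn : j ≤ n) :
    (g.restrict n).restrict j = g.restrict j :=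
  (Finset.filter_filter _ _ _).trans
    (Finset.filter_congr fun _ _ => ⟨And.right, fun h => ⟨h.trans hjn, h⟩⟩)

lemma Graph.IsRecursive.restrict_attach {g : Graph} {n : ℕ} (hg : g.IsRecursive n)
    (A : Finset ℕ) : (g.attach (n + 1) A).restrict n = g := by
  have : (g.edges ∪ ({n + 1} : Finset ℕ) ×ˢ A).filter (fun e => e.1 ≤ n) = g.edges := by
    ext e
    simp only [Finset.mem_filter, Finset.mem_union, Finset.mem_product, Finset.mem_singleton]
    constructor
    · rintro ⟨h | ⟨h, -⟩, h2⟩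
      · exact h
      · omega
    · exact fun h => ⟨Or.inl h, (hg e h).2.2⟩
  exact this

lemma Graph.IsRecursive.indeg_succ_le {g : Graph} {n : ℕ} (hg : g.IsRecursive n) {m : ℕ}
    (hm : m ∈ Finset.Icc 1 n) : g.indeg m + 1 ≤ n := by
  have h : g.indeg m ≤ (Finset.Ioc m n).card := by
    refine Finset.card_le_card_of_injOn Prod.fst (fun e he => ?_) fun e he e' he' h => ?_
    · rw [Finset.mem_coe, Finset.mem_filter] at he
      have := hg e he.1
      rw [Finset.mem_coe, Finset.mem_Ioc]
      omega
    · rw [Finset.mem_coe, Finset.mem_filter] at he he'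
      exact Prod.ext h (he.2.trans he'.2.symm)
  rw [Nat.card_Ioc] at h
  have := Finset.mem_Icc.1 hm
  omega

lemma finite_setOf_isRecursive (n : ℕ) : {g : Graph | g.IsRecursive n}.Finite := by
  refine ((Finset.Icc 1 n ×ˢ Finset.Icc 1 n).powerset.finite_toSet).subset fun g hg => ?_
  refine Finset.mem_coe.2 (Finset.mem_powerset.2 fun e he => ?_)
  have := hg e he
  rw [Finset.mem_product, Finset.mem_Icc, Finset.mem_Icc]
  omega

/-- The probability `f (g.indeg m) / n` of an edge from the new vertex `n + 1` to `m`. -/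
noncomputable def linkProb (f : ℕ → ℝ) (n : ℕ) (g : Graph) (m : ℕ) : ℝ := f (g.indeg m) / n

lemma linkProb_mem {f : ℕ → ℝ} (hf : ∀ k, 0 < f k) (hle : ∀ k : ℕ, f k ≤ (k : ℝ) + 1)
    {g : Graph} {n : ℕ} (hg : g.IsRecursive n) {m : ℕ} (hm : m ∈ Finset.Icc 1 n) :
    0 ≤ linkProb f n g m ∧ linkProb f n g m ≤ 1 := by
  have h := hg.indeg_succ_le hm
  have hn : (0 : ℝ) < n := by exact_mod_cast (show 0 < n by omega)
  refine ⟨div_nonneg (hf _).le hn.le, (div_le_one hn).2 ((hle _).trans ?_)⟩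
  exact_mod_cast h

/-- The sum of `φ` over the indegrees of the vertices `1, …, n`. -/
def degSum (φ : ℕ → ℝ) (n : ℕ) (g : Graph) : ℝ := ∑ m ∈ Finset.Icc 1 n, φ (g.indeg m)

/-- The conditional expectation, given that the graph at time `n` is `g`, of the next increment
of `degSum φ`, when `φ 0 = 0`. -/
noncomputable def degDrift (f φ : ℕ → ℝ) (n : ℕ) (g : Graph) : ℝ :=
  ∑ m ∈ Finset.Icc 1 n, (φ (g.indeg m + 1) - φ (g.indeg m)) * linkProb f n g m

lemma degSum_attach {φ : ℕ → ℝ} (h0 : φ 0 = 0) {g : Graph} {n : ℕ} (hg : g.IsRecursive n)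
    {A : Finset ℕ} (hA : A ⊆ Finset.Icc 1 n) :
    degSum φ (n + 1) (g.attach (n + 1) A) =
      degSum φ n g + ∑ m ∈ A, (φ (g.indeg m + 1) - φ (g.indeg m)) := by
  have hA' : n + 1 ∉ A := fun h => by simpa using hA h
  unfold degSum
  rw [Finset.sum_Icc_succ_top (by omega), hg.indeg_attach, hg.indeg_succ_eq_zero, if_neg hA', h0,
    add_zero, ← Finset.inter_eq_right.2 hA, ← Finset.filter_mem_eq_inter, Finset.sum_filter,
    ← Finset.sum_add_distrib]
  refine Finset.sum_congr rfl fun m hm => ?_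
  rw [hg.indeg_attach, Finset.filter_mem_eq_inter, Finset.inter_eq_right.2 hA]
  split_ifs <;> simp

/-- The increment of `degSum φ`, centred by its conditional expectation. -/
noncomputable def degNoise (f φ : ℕ → ℝ) (n : ℕ) (g g' : Graph) : ℝ :=
  degSum φ (n + 1) g' - degSum φ n g - degDrift f φ n g

lemma bernSum_degNoise {f φ : ℕ → ℝ} (h0 : φ 0 = 0) {g : Graph} {n : ℕ} (hg : g.IsRecursive n) :
    bernSum (Finset.Icc 1 n) (linkProb f n g) (fun A => degNoise f φ n g (g.attach (n + 1) A))
      = 0 := by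
  rw [bernSum_congr (F' := fun A => ∑ m ∈ A, (φ (g.indeg m + 1) - φ (g.indeg m)) +
    -degDrift f φ n g), bernSum_sum_add, degDrift, add_neg_cancel]
  intro A hA
  rw [degNoise, degSum_attach h0 hg hA]
  ring

lemma bernSum_degNoise_sq_le {f φ : ℕ → ℝ} (hf : ∀ k, 0 < f k)
    (hle : ∀ k : ℕ, f k ≤ (k : ℝ) + 1) (h0 : φ 0 = 0)
    (hφ : ∀ k, 0 ≤ φ (k + 1) - φ k ∧ φ (k + 1) - φ k ≤ 1) {g : Graph} {n : ℕ}
    (hg : g.IsRecursive n) :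
    bernSum (Finset.Icc 1 n) (linkProb f n g)
      (fun A => degNoise f φ n g (g.attach (n + 1) A) ^ 2) ≤ degDrift f φ n g := by
  rw [bernSum_congr (F' := fun A => (∑ m ∈ A, (φ (g.indeg m + 1) - φ (g.indeg m)) +
    -degDrift f φ n g) ^ 2), bernSum_sum_add_sq, ← degDrift, add_neg_cancel]
  · rw [zero_pow two_ne_zero, add_zero]
    refine Finset.sum_le_sum fun m hm => ?_
    obtain ⟨h1, h2⟩ := linkProb_mem hf hle hg hm
    obtain ⟨h3, h4⟩ := hφ (g.indeg m)
    refine mul_le_mul (by nlinarith) (by nlinarith) (by nlinarith) h3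
  · intro A hA
    rw [degNoise, degSum_attach h0 hg hA]
    ring

/-! ### A version of the network with regular paths -/

variable {Ω : Type*} [MeasurableSpace Ω]

/-- A network all of whose paths, and not only almost all of them, grow from the empty graph by
adding the vertices one by one. Time `0`, with no vertices, is included. -/
structure IsRegularNetwork (f : ℕ → ℝ) (P : Measure Ω) (H : ℕ → Ω → Graph) : Prop where
  measurable : ∀ n, Measurable (H n)
  zero : ∀ ω, H 0 ω = Graph.ofEdges ∅
  exists_attach : ∀ n ω, ∃ A ⊆ Finset.Icc 1 n, H (n + 1) ω = (H n ω).attach (n + 1) A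
  step : ∀ n, 1 ≤ n → ∀ g : Graph, ∀ A ⊆ Finset.Icc 1 n,
    P {ω | H n ω = g ∧ H (n + 1) ω = g.attach (n + 1) A} =
      P {ω | H n ω = g} *
        ((∏ m ∈ A, ENNReal.ofReal (f (g.indeg m) / n)) *
          ∏ m ∈ Finset.Icc 1 n \ A, ENNReal.ofReal (1 - f (g.indeg m) / n))

lemma ofReal_weight {f : ℕ → ℝ} (hf : ∀ k, 0 < f k) (hle : ∀ k : ℕ, f k ≤ (k : ℝ) + 1)
    {g : Graph} {n : ℕ} (hg : g.IsRecursive n) {A : Finset ℕ} (hA : A ⊆ Finset.Icc 1 n) :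
    (∏ m ∈ A, ENNReal.ofReal (f (g.indeg m) / n)) *
        ∏ m ∈ Finset.Icc 1 n \ A, ENNReal.ofReal (1 - f (g.indeg m) / n) =
      ENNReal.ofReal ((∏ m ∈ A, linkProb f n g m) *
        ∏ m ∈ Finset.Icc 1 n \ A, (1 - linkProb f n g m)) ∧
    0 ≤ (∏ m ∈ A, linkProb f n g m) * ∏ m ∈ Finset.Icc 1 n \ A, (1 - linkProb f n g m) := by
  have h1 : ∀ m ∈ A, 0 ≤ linkProb f n g m := fun m hm => (linkProb_mem hf hle hg (hA hm)).1
  have h2 : ∀ m ∈ Finset.Icc 1 n \ A, 0 ≤ 1 - linkProb f n g m := fun m hm =>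
    sub_nonneg.2 (linkProb_mem hf hle hg (Finset.mem_sdiff.1 hm).1).2
  refine ⟨?_, mul_nonneg (Finset.prod_nonneg h1) (Finset.prod_nonneg h2)⟩
  rw [ENNReal.ofReal_mul (Finset.prod_nonneg h1), ENNReal.ofReal_prod_of_nonneg h1,
    ENNReal.ofReal_prod_of_nonneg h2]
  rfl

/-- The prescribed transition probabilities sum to one, so almost surely the graph grows by
attaching a vertex. -/
lemma IsNetwork.ae_exists_attach {f : ℕ → ℝ} {P : Measure Ω} [IsProbabilityMeasure P]
    {G : ℕ → Ω → Graph} (hG : IsNetwork f P G) (hf : ∀ k, 0 < f k)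
    (hle : ∀ k : ℕ, f k ≤ (k : ℝ) + 1) {n : ℕ} (hn : 1 ≤ n) :
    ∀ᵐ ω ∂P, (G n ω).IsRecursive n →
      ∃ A ⊆ Finset.Icc 1 n, G (n + 1) ω = (G n ω).attach (n + 1) A := by
  suffices h : ∀ g : Graph, g.IsRecursive n → ∀ᵐ ω ∂P, G n ω = g →
      ∃ A ⊆ Finset.Icc 1 n, G (n + 1) ω = g.attach (n + 1) A by
    have h' : ∀ᵐ ω ∂P, ∀ g : Graph, g.IsRecursive n → G n ω = g →
        ∃ A ⊆ Finset.Icc 1 n, G (n + 1) ω = g.attach (n + 1) A := by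
      rw [ae_all_iff]
      intro g
      by_cases hg : g.IsRecursive n
      · exact (h g hg).mono fun ω hω _ => hω
      · exact Eventually.of_forall fun ω hg' => absurd hg' hg
    exact h'.mono fun ω hω hrec => hω _ hrec rfl
  intro g hg
  set E : Finset ℕ → Set Ω := fun A => {ω | G n ω = g ∧ G (n + 1) ω = g.attach (n + 1) A} with hE
  have hEm : ∀ A, MeasurableSet (E A) := fun A =>
    (measurableSet_eq_fun (hG.measurable n hn) measurable_const).inter
      (measurableSet_eq_fun (hG.measurable (n + 1) (by omega)) measurable_const)
  have hsub : (⋃ A ∈ (Finset.Icc 1 n).powerset, E A) ⊆ {ω | G n ω = g} :=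
    Set.iUnion₂_subset fun A _ ω hω => hω.1
  have hmeas : P (⋃ A ∈ (Finset.Icc 1 n).powerset, E A) = P {ω | G n ω = g} := by
    rw [measure_biUnion_finset]
    · rw [Finset.sum_congr rfl fun A hA => (hG.step n hn g A (Finset.mem_powerset.1 hA)).trans
        (congrArg _ (ofReal_weight hf hle hg (Finset.mem_powerset.1 hA)).1), ← Finset.mul_sum,
        ← ENNReal.ofReal_sum_of_nonneg fun A hA =>
          (ofReal_weight hf hle hg (Finset.mem_powerset.1 hA)).2]
      have := bernSum_const (Finset.Icc 1 n) (linkProb f n g) 1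
      simp only [bernSum, mul_one] at this
      rw [this, ENNReal.ofReal_one, mul_one]
    · intro A _ B _ hAB
      exact Set.disjoint_left.2 fun ω h1 h2 => hAB (hg.attach_injective (h1.2.symm.trans h2.2))
    · exact fun A _ => hEm A
  have hae := ae_eq_of_subset_of_measure_ge hsub hmeas.ge
    (Finset.measurableSet_biUnion _ fun A _ => hEm A).nullMeasurableSet (measure_ne_top _ _)
  filter_upwards [hae.mem_iff] with ω hω hg'
  obtain ⟨A, hA, h⟩ := Set.mem_iUnion₂.1 (hω.2 hg')
  exact ⟨A, Finset.mem_powerset.1 hA, h.2⟩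

lemma IsNetwork.exists_isRegularNetwork {f : ℕ → ℝ} {P : Measure Ω} [IsProbabilityMeasure P]
    {G : ℕ → Ω → Graph} (hG : IsNetwork f P G) (hf : ∀ k, 0 < f k)
    (hle : ∀ k : ℕ, f k ≤ (k : ℝ) + 1) :
    ∃ H, IsRegularNetwork f P H ∧ ∀ᵐ ω ∂P, ∀ n, 1 ≤ n → G n ω = H n ω := by
  classical
  set S : Set Ω := {ω | G 1 ω = Graph.ofEdges ∅ ∧ ∀ n, 1 ≤ n →
    ∃ A ⊆ Finset.Icc 1 n, G (n + 1) ω = (G n ω).attach (n + 1) A} with hS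
  have hSm : MeasurableSet S := by
    have hS' : S = {ω | G 1 ω = Graph.ofEdges ∅} ∩ ⋂ n : ℕ, ⋂ (_ : 1 ≤ n),
        {ω | ∃ A ⊆ Finset.Icc 1 n, G (n + 1) ω = (G n ω).attach (n + 1) A} := by
      ext ω
      simp [hS]
    rw [hS']
    refine (measurableSet_eq_fun (hG.measurable 1 le_rfl) measurable_const).inter ?_
    refine MeasurableSet.iInter fun n => MeasurableSet.iInter fun hn => ?_
    exact ((hG.measurable n hn).prodMk (hG.measurable (n + 1) (by omega)))
      (MeasurableSet.of_discrete (s := {q : Graph × Graph |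
        ∃ A ⊆ Finset.Icc 1 n, q.2 = q.1.attach (n + 1) A}))
  have hSae : ∀ᵐ ω ∂P, ω ∈ S := by
    have h1 : ∀ᵐ ω ∂P, ∀ n, 1 ≤ n → (G n ω).IsRecursive n →
        ∃ A ⊆ Finset.Icc 1 n, G (n + 1) ω = (G n ω).attach (n + 1) A :=
      ae_all_iff.2 fun n => by
        by_cases hn : 1 ≤ n
        · exact (hG.ae_exists_attach hf hle hn).mono fun ω h _ => h
        · exact Eventually.of_forall fun ω h => absurd h hn
    filter_upwards [hG.initial, h1] with ω h0 h1
    refine ⟨h0, fun n hn => h1 n hn ?_⟩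
    induction n, hn using Nat.le_induction with
    | base => rw [h0]; intro e he; simp [Graph.edges, Graph.ofEdges] at he
    | succ n hn ih =>
      obtain ⟨A, hA, h⟩ := h1 n hn ih
      rw [h]
      exact ih.attach hA
  have hae : ∀ᵐ ω ∂P, ∀ n, 1 ≤ n →
      G n ω = if 1 ≤ n ∧ ω ∈ S then G n ω else Graph.ofEdges ∅ := by
    filter_upwards [hSae] with ω hω n hn
    rw [if_pos ⟨hn, hω⟩]
  have hattach : ∀ v, (Graph.ofEdges ∅).attach v ∅ = Graph.ofEdges ∅ := fun v => by
    simp only [Graph.attach, Graph.edges, Finset.product_empty]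
    rfl
  refine ⟨fun n ω => if 1 ≤ n ∧ ω ∈ S then G n ω else Graph.ofEdges ∅,
    ⟨fun n => ?_, fun ω => by simp, fun n ω => ?_, fun n hn g A hA => ?_⟩, hae⟩
  · by_cases hn : 1 ≤ n
    · simp only [hn, true_and]
      exact Measurable.ite hSm (hG.measurable n hn) measurable_const
    · simp only [hn, false_and, if_false]
      exact measurable_const
  · by_cases hω : ω ∈ S
    · rcases Nat.eq_zero_or_pos n with rfl | hn
      · refine ⟨∅, Finset.empty_subset _, ?_⟩
        simp only [zero_add, le_refl, hω, and_self, if_true]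
        simpa using hω.1.trans (hattach 1).symm
      · have hn' : 1 ≤ n := hn
        simpa [hn', hω] using hω.2 n hn
    · refine ⟨∅, Finset.empty_subset _, ?_⟩
      simp [hω, hattach]
  · have h1 : P {ω | (if 1 ≤ n ∧ ω ∈ S then G n ω else Graph.ofEdges ∅) = g} =
        P {ω | G n ω = g} := measure_congr <| by
      filter_upwards [hae] with ω hω
      exact propext (Eq.congr_left (hω n hn)).symm
    have h2 : P {ω | (if 1 ≤ n ∧ ω ∈ S then G n ω else Graph.ofEdges ∅) = g ∧
        (if 1 ≤ n + 1 ∧ ω ∈ S then G (n + 1) ω else Graph.ofEdges ∅) = g.attach (n + 1) A} =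
        P {ω | G n ω = g ∧ G (n + 1) ω = g.attach (n + 1) A} := measure_congr <| by
      filter_upwards [hae] with ω hω
      exact propext (and_congr (Eq.congr_left (hω n hn))
        (Eq.congr_left (hω (n + 1) (by omega)))).symm
    rw [h1, h2, hG.step n hn g A hA]

namespace IsRegularNetwork

variable {f : ℕ → ℝ} {P : Measure Ω} {H : ℕ → Ω → Graph}

lemma isRecursive (hH : IsRegularNetwork f P H) (n : ℕ) (ω : Ω) : (H n ω).IsRecursive n := by
  induction n with
  | zero => rw [hH.zero]; intro e he; simp [Graph.edges, Graph.ofEdges] at he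
  | succ n ih =>
    obtain ⟨A, hA, h⟩ := hH.exists_attach n ω
    rw [h]
    exact ih.attach hA

lemma restrict_eq (hH : IsRegularNetwork f P H) {j n : ℕ} (hjn : j ≤ n) (ω : Ω) :
    (H n ω).restrict j = H j ω := by
  induction n, hjn using Nat.le_induction with
  | base =>
    exact Finset.filter_true_of_mem fun e he => (hH.isRecursive j ω e he).2.2
  | succ n hn ih =>
    obtain ⟨A, hA, h⟩ := hH.exists_attach n ω
    rw [← ih]
    have h1 : (H (n + 1) ω).restrict n = H n ω := by
      rw [h, (hH.isRecursive n ω).restrict_attach]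
    rw [← h1, Graph.restrict_restrict _ hn]

/-! ### One-step expectations -/

lemma integrable_comp [IsFiniteMeasure P] (hH : IsRegularNetwork f P H) (n : ℕ)
    (F : Graph → Graph → ℝ) : Integrable (fun ω => F (H n ω) (H (n + 1) ω)) P := by
  set V : ℕ → Finset Graph := fun n => (finite_setOf_isRecursive n).toFinset
  have hV : ∀ n ω, H n ω ∈ V n := fun n ω =>
    (finite_setOf_isRecursive n).mem_toFinset.2 (hH.isRecursive n ω)
  refine Integrable.of_bound (C := ∑ q ∈ V n ×ˢ V (n + 1), |F q.1 q.2|) ?_ ?_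
  · exact ((Measurable.of_discrete (f := fun q : Graph × Graph => F q.1 q.2)).comp
      ((hH.measurable n).prodMk (hH.measurable (n + 1)))).aestronglyMeasurable
  · refine Eventually.of_forall fun ω => ?_
    exact Finset.single_le_sum (f := fun q : Graph × Graph => |F q.1 q.2|)
      (fun q _ => abs_nonneg _) (a := (H n ω, H (n + 1) ω))
      (Finset.mem_product.2 ⟨hV n ω, hV (n + 1) ω⟩)

lemma integrable_comp' [IsFiniteMeasure P] (hH : IsRegularNetwork f P H) (n : ℕ)
    (F : Graph → ℝ) : Integrable (fun ω => F (H n ω)) P :=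
  hH.integrable_comp n fun g _ => F g

lemma measureReal_step (hH : IsRegularNetwork f P H) (hf : ∀ k, 0 < f k)
    (hle : ∀ k : ℕ, f k ≤ (k : ℝ) + 1) {n : ℕ} (hn : 1 ≤ n) {g : Graph} (hg : g.IsRecursive n)
    {A : Finset ℕ} (hA : A ⊆ Finset.Icc 1 n) :
    P.real {ω | H n ω = g ∧ H (n + 1) ω = g.attach (n + 1) A} =
      P.real {ω | H n ω = g} * ((∏ m ∈ A, linkProb f n g m) *
        ∏ m ∈ Finset.Icc 1 n \ A, (1 - linkProb f n g m)) := by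
  obtain ⟨h1, h2⟩ := ofReal_weight hf hle hg hA
  rw [measureReal_def, hH.step n hn g A hA, h1, ENNReal.toReal_mul, ENNReal.toReal_ofReal h2,
    measureReal_def]

lemma setIntegral_step [IsFiniteMeasure P] (hH : IsRegularNetwork f P H) (hf : ∀ k, 0 < f k)
    (hle : ∀ k : ℕ, f k ≤ (k : ℝ) + 1) {n : ℕ} (hn : 1 ≤ n) {g : Graph} (hg : g.IsRecursive n)
    (F : Graph → ℝ) :
    ∫ ω in {ω | H n ω = g}, F (H (n + 1) ω) ∂P = P.real {ω | H n ω = g} *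
      bernSum (Finset.Icc 1 n) (linkProb f n g) (fun A => F (g.attach (n + 1) A)) := by
  set E : Finset ℕ → Set Ω := fun A => {ω | H n ω = g ∧ H (n + 1) ω = g.attach (n + 1) A} with hE
  have hEm : ∀ A, MeasurableSet (E A) := fun A =>
    (measurableSet_eq_fun (hH.measurable n) measurable_const).inter
      (measurableSet_eq_fun (hH.measurable (n + 1)) measurable_const)
  have hU : {ω | H n ω = g} = ⋃ A ∈ (Finset.Icc 1 n).powerset, E A := by
    ext ω
    simp only [hE, Set.mem_iUnion, Finset.mem_powerset, Set.mem_ofPred_eq]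
    constructor
    · intro h
      obtain ⟨A, hA, h'⟩ := hH.exists_attach n ω
      exact ⟨A, hA, h, h ▸ h'⟩
    · rintro ⟨A, _, h, _⟩
      exact h
  conv_lhs => rw [hU]
  rw [integral_biUnion_finset _ (fun A _ => hEm A)]
  · rw [bernSum, Finset.mul_sum]
    refine Finset.sum_congr rfl fun A hA => ?_
    rw [setIntegral_congr_fun (hEm A) (g := fun _ => F (g.attach (n + 1) A))
      (fun ω hω => by simp only [hω.2]), setIntegral_const,
      hH.measureReal_step hf hle hn hg (Finset.mem_powerset.1 hA), smul_eq_mul, mul_assoc]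
  · intro A _ B _ hAB
    exact Set.disjoint_left.2 fun ω h1 h2 => hAB (hg.attach_injective (h1.2.symm.trans h2.2))
  · exact fun A _ => (hH.integrable_comp' (n + 1) F).integrableOn

lemma integral_step [IsFiniteMeasure P] (hH : IsRegularNetwork f P H) (hf : ∀ k, 0 < f k)
    (hle : ∀ k : ℕ, f k ≤ (k : ℝ) + 1) {n : ℕ} (hn : 1 ≤ n) (F : Graph → Graph → ℝ) :
    ∫ ω, F (H n ω) (H (n + 1) ω) ∂P = ∫ ω, bernSum (Finset.Icc 1 n) (linkProb f n (H n ω))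
      (fun A => F (H n ω) ((H n ω).attach (n + 1) A)) ∂P := by
  set V : Finset Graph := (finite_setOf_isRecursive n).toFinset
  have hU : (Set.univ : Set Ω) = ⋃ g ∈ V, {ω | H n ω = g} := by
    ext ω
    simp [V, hH.isRecursive n ω]
  have hm : ∀ g, MeasurableSet {ω | H n ω = g} := fun g =>
    measurableSet_eq_fun (hH.measurable n) measurable_const
  have hd : Set.Pairwise (↑V) (Function.onFun Disjoint fun g => {ω | H n ω = g}) :=
    fun g _ g' _ hgg' => Set.disjoint_left.2 fun ω h1 h2 => hgg' (h1.symm.trans h2)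
  rw [← setIntegral_univ, ← setIntegral_univ (μ := P), hU,
    integral_biUnion_finset _ (fun g _ => hm g) hd
      fun g _ => (hH.integrable_comp n F).integrableOn,
    integral_biUnion_finset _ (fun g _ => hm g) hd
      fun g _ => (hH.integrable_comp' n fun g => bernSum (Finset.Icc 1 n) (linkProb f n g)
        (fun A => F g (g.attach (n + 1) A))).integrableOn]
  refine Finset.sum_congr rfl fun g hg => ?_
  rw [setIntegral_congr_fun (hm g) (g := fun ω => F g (H (n + 1) ω))
      (fun ω hω => by simp only [show H n ω = g from hω]),
    hH.setIntegral_step hf hle hn ((finite_setOf_isRecursive n).mem_toFinset.1 hg),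
    setIntegral_congr_fun (hm g) (g := fun _ => bernSum (Finset.Icc 1 n) (linkProb f n g)
      (fun A => F g (g.attach (n + 1) A))) (fun ω hω => by simp only [show H n ω = g from hω]),
    setIntegral_const, smul_eq_mul]

/-! ### The noise martingale -/

/-- The noise is orthogonal to everything that the current graph determines. -/
lemma integral_mul_degNoise [IsFiniteMeasure P] (hH : IsRegularNetwork f P H)
    (hf : ∀ k, 0 < f k) (hle : ∀ k : ℕ, f k ≤ (k : ℝ) + 1) {φ : ℕ → ℝ} (h0 : φ 0 = 0) {n : ℕ}
    (hn : 1 ≤ n) (h : Graph → ℝ) :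
    ∫ ω, h (H n ω) * degNoise f φ n (H n ω) (H (n + 1) ω) ∂P = 0 := by
  rw [hH.integral_step hf hle hn fun g g' => h g * degNoise f φ n g g']
  simp only [bernSum_const_mul, bernSum_degNoise h0 (hH.isRecursive n _), mul_zero,
    integral_zero]

lemma integral_degNoise_sq_le [IsFiniteMeasure P] (hH : IsRegularNetwork f P H)
    (hf : ∀ k, 0 < f k) (hle : ∀ k : ℕ, f k ≤ (k : ℝ) + 1) {φ : ℕ → ℝ} (h0 : φ 0 = 0)
    (hφ : ∀ k, 0 ≤ φ (k + 1) - φ k ∧ φ (k + 1) - φ k ≤ 1) {n : ℕ} (hn : 1 ≤ n) :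
    ∫ ω, degNoise f φ n (H n ω) (H (n + 1) ω) ^ 2 ∂P ≤ ∫ ω, degDrift f φ n (H n ω) ∂P := by
  rw [hH.integral_step hf hle hn fun g g' => degNoise f φ n g g' ^ 2]
  exact integral_mono
    (hH.integrable_comp' n fun g => bernSum (Finset.Icc 1 n) (linkProb f n g)
      (fun A => degNoise f φ n g (g.attach (n + 1) A) ^ 2))
    (hH.integrable_comp' n (degDrift f φ n))
    fun ω => bernSum_degNoise_sq_le hf hle h0 hφ (hH.isRecursive n ω)

/-- The expectation of `degSum φ` grows by the expected drift. -/
lemma integral_degSum_succ [IsFiniteMeasure P] (hH : IsRegularNetwork f P H)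
    (hf : ∀ k, 0 < f k) (hle : ∀ k : ℕ, f k ≤ (k : ℝ) + 1) {φ : ℕ → ℝ} (h0 : φ 0 = 0) {n : ℕ}
    (hn : 1 ≤ n) :
    ∫ ω, degSum φ (n + 1) (H (n + 1) ω) ∂P =
      ∫ ω, degSum φ n (H n ω) ∂P + ∫ ω, degDrift f φ n (H n ω) ∂P := by
  have h1 := hH.integral_mul_degNoise hf hle h0 hn fun _ => 1
  have i1 := hH.integrable_comp' (n + 1) (degSum φ (n + 1))
  have i2 := hH.integrable_comp' n (degSum φ n)
  have i3 := hH.integrable_comp' n (degDrift f φ n)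
  simp only [one_mul, degNoise] at h1
  rw [integral_sub (by exact i1.sub i2) i3, integral_sub i1 i2] at h1
  linarith

/-- The filtration generated by the regular network, with time shifted by one: the graph at a
later time determines the graphs at earlier times. -/
def filtration (hH : IsRegularNetwork f P H) :
    Filtration ℕ (inferInstance : MeasurableSpace Ω) where
  seq n := MeasurableSpace.comap (H (n + 1)) ⊤
  mono' i j hij := by
    have h : H (i + 1) = (fun g : Graph => g.restrict (i + 1)) ∘ H (j + 1) :=
      funext fun ω => (hH.restrict_eq (by omega) ω).symm
    change MeasurableSpace.comap (H (i + 1)) ⊤ ≤ MeasurableSpace.comap (H (j + 1)) ⊤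
    rw [h, ← MeasurableSpace.comap_comp]
    exact MeasurableSpace.comap_mono le_top
  le' n := (hH.measurable (n + 1)).comap_le

/-- The sum of the noise terms up to time `n`, weighted by the step sizes, as a function of the
graph at time `n + 1`. -/
noncomputable def noiseSum (f φ : ℕ → ℝ) (n : ℕ) (g : Graph) : ℝ :=
  ∑ j ∈ Finset.range n,
    degNoise f φ (j + 1) (g.restrict (j + 1)) (g.restrict (j + 1 + 1)) / ((j : ℝ) + 2)

lemma noiseSum_eq (hH : IsRegularNetwork f P H) (φ : ℕ → ℝ) (n : ℕ) (ω : Ω) :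
    noiseSum f φ n (H (n + 1) ω) = ∑ j ∈ Finset.range n,
      degNoise f φ (j + 1) (H (j + 1) ω) (H (j + 1 + 1) ω) / ((j : ℝ) + 2) := by
  refine Finset.sum_congr rfl fun j hj => ?_
  have := Finset.mem_range.1 hj
  rw [hH.restrict_eq (by omega), hH.restrict_eq (by omega)]

lemma noiseSum_succ (hH : IsRegularNetwork f P H) (φ : ℕ → ℝ) (n : ℕ) (ω : Ω) :
    noiseSum f φ (n + 1) (H (n + 1 + 1) ω) = noiseSum f φ n (H (n + 1) ω) +
      degNoise f φ (n + 1) (H (n + 1) ω) (H (n + 1 + 1) ω) / ((n : ℝ) + 2) := by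
  rw [hH.noiseSum_eq, hH.noiseSum_eq, Finset.sum_range_succ]

lemma martingale_noiseSum [IsFiniteMeasure P] (hH : IsRegularNetwork f P H)
    (hf : ∀ k, 0 < f k) (hle : ∀ k : ℕ, f k ≤ (k : ℝ) + 1) {φ : ℕ → ℝ} (h0 : φ 0 = 0) :
    Martingale (fun n ω => noiseSum f φ n (H (n + 1) ω)) hH.filtration P := by
  refine martingale_of_setIntegral_eq_succ (fun n => ?_)
    (fun n => hH.integrable_comp' (n + 1) (noiseSum f φ n)) fun n s hs => ?_
  · exact ((Measurable.of_discrete (f := noiseSum f φ n)).comp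
      (comap_measurable (H (n + 1)))).stronglyMeasurable
  · obtain ⟨t, -, rfl⟩ := hs
    have ht : MeasurableSet (H (n + 1) ⁻¹' t) := hH.measurable (n + 1) MeasurableSet.of_discrete
    have h1 := hH.integral_mul_degNoise hf hle h0 (n := n + 1) (by omega)
      (t.indicator fun _ => ((n : ℝ) + 2)⁻¹)
    have h2 : ∫ ω in H (n + 1) ⁻¹' t,
        degNoise f φ (n + 1) (H (n + 1) ω) (H (n + 1 + 1) ω) / ((n : ℝ) + 2) ∂P = 0 := by
      rw [← integral_indicator ht, ← h1]
      congr 1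
      funext ω
      by_cases hω : H (n + 1) ω ∈ t
      · rw [Set.indicator_of_mem (by exact hω), Set.indicator_of_mem hω, div_eq_inv_mul]
      · rw [Set.indicator_of_notMem (by exact hω), Set.indicator_of_notMem hω, zero_mul]
    simp only [hH.noiseSum_succ]
    rw [integral_add (hH.integrable_comp' (n + 1) (noiseSum f φ n)).integrableOn
      ((hH.integrable_comp (n + 1) (degNoise f φ (n + 1))).div_const _).integrableOn, h2, add_zero]

/-- The increments of the noise martingale are orthogonal, and `∑ 1 / (n + 2) ^ 2 ≤ 1`, so the
martingale is bounded in `L²`. -/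
lemma integral_noiseSum_sq_le [IsFiniteMeasure P] (hH : IsRegularNetwork f P H)
    (hf : ∀ k, 0 < f k) (hle : ∀ k : ℕ, f k ≤ (k : ℝ) + 1) {φ : ℕ → ℝ} (h0 : φ 0 = 0)
    (hφ : ∀ k, 0 ≤ φ (k + 1) - φ k ∧ φ (k + 1) - φ k ≤ 1) {C : ℝ} (hC0 : 0 ≤ C)
    (hC : ∀ n, 1 ≤ n → ∫ ω, degDrift f φ n (H n ω) ∂P ≤ C) (n : ℕ) :
    ∫ ω, noiseSum f φ n (H (n + 1) ω) ^ 2 ∂P ≤ C * (1 - 1 / ((n : ℝ) + 1)) := by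
  induction n with
  | zero => simp [noiseSum]
  | succ n ih =>
    set ξ : Ω → ℝ := fun ω => degNoise f φ (n + 1) (H (n + 1) ω) (H (n + 1 + 1) ω)
    have h1 := hH.integral_mul_degNoise hf hle h0 (n := n + 1) (by omega) (noiseSum f φ n)
    have h2 := (hH.integral_degNoise_sq_le hf hle h0 hφ (n := n + 1) (by omega)).trans
      (hC (n + 1) (by omega))
    have i1 : Integrable (fun ω => noiseSum f φ n (H (n + 1) ω) ^ 2) P :=
      hH.integrable_comp' (n + 1) fun g => noiseSum f φ n g ^ 2
    have i2 : Integrable (fun ω => 2 / ((n : ℝ) + 2) *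
        (noiseSum f φ n (H (n + 1) ω) * ξ ω)) P :=
      (hH.integrable_comp (n + 1) fun g g' =>
        noiseSum f φ n g * degNoise f φ (n + 1) g g').const_mul _
    have i3 : Integrable (fun ω => 1 / ((n : ℝ) + 2) ^ 2 * ξ ω ^ 2) P :=
      (hH.integrable_comp (n + 1) fun g g' => degNoise f φ (n + 1) g g' ^ 2).const_mul _
    have h3 : ∀ ω, noiseSum f φ (n + 1) (H (n + 1 + 1) ω) ^ 2 =
        noiseSum f φ n (H (n + 1) ω) ^ 2 +
          2 / ((n : ℝ) + 2) * (noiseSum f φ n (H (n + 1) ω) * ξ ω) +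
          1 / ((n : ℝ) + 2) ^ 2 * ξ ω ^ 2 := fun ω => by
      rw [hH.noiseSum_succ]
      simp only [ξ]
      field_simp
      ring
    rw [integral_congr_ae (Eventually.of_forall h3), integral_add (by exact i1.add i2) i3,
      integral_add i1 i2, integral_const_mul, integral_const_mul, h1, mul_zero, add_zero]
    have h4 : 1 / ((n : ℝ) + 2) ^ 2 * ∫ ω, ξ ω ^ 2 ∂P ≤ 1 / ((n : ℝ) + 2) ^ 2 * C :=
      mul_le_mul_of_nonneg_left h2 (by positivity)
    have h5 : 1 / ((n : ℝ) + 2) ^ 2 ≤ 1 / ((n : ℝ) + 1) - 1 / ((n : ℝ) + 1 + 1) := by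
      rw [div_sub_div _ _ (by positivity) (by positivity), div_le_div_iff₀ (by positivity)
        (by positivity)]
      nlinarith
    have h6 := mul_le_mul_of_nonneg_right h5 hC0
    push_cast
    linarith

/-- The weighted noise series converges almost surely as soon as the expected drift is
bounded. -/
lemma ae_tendsto_noiseSum [IsProbabilityMeasure P] (hH : IsRegularNetwork f P H)
    (hf : ∀ k, 0 < f k) (hle : ∀ k : ℕ, f k ≤ (k : ℝ) + 1) {φ : ℕ → ℝ} (h0 : φ 0 = 0)
    (hφ : ∀ k, 0 ≤ φ (k + 1) - φ k ∧ φ (k + 1) - φ k ≤ 1) {C : ℝ} (hC0 : 0 ≤ C)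
    (hC : ∀ n, 1 ≤ n → ∫ ω, degDrift f φ n (H n ω) ∂P ≤ C) :
    ∀ᵐ ω ∂P, ∃ l, Tendsto (fun n => ∑ j ∈ Finset.range n,
      degNoise f φ (j + 1) (H (j + 1) ω) (H (j + 1 + 1) ω) / ((j : ℝ) + 2)) atTop (𝓝 l) := by
  have h := (hH.martingale_noiseSum hf hle h0).submartingale.exists_ae_tendsto_of_bdd
    (R := (1 + C).toNNReal) fun n => by
      have i1 := hH.integrable_comp' (n + 1) (noiseSum f φ n)
      have i2 := hH.integrable_comp' (n + 1) fun g => noiseSum f φ n g ^ 2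
      rw [eLpNorm_one_eq_lintegral_enorm, ← ofReal_integral_norm_eq_lintegral_enorm i1]
      refine ENNReal.ofReal_le_ofReal ?_
      have h1 : ∫ ω, ‖noiseSum f φ n (H (n + 1) ω)‖ ∂P ≤
          ∫ ω, (1 + noiseSum f φ n (H (n + 1) ω) ^ 2) ∂P := by
        refine integral_mono i1.norm ((integrable_const 1).add i2) fun ω => ?_
        rw [Real.norm_eq_abs, ← sq_abs]
        nlinarith [sq_nonneg (|noiseSum f φ n (H (n + 1) ω)| - 1),
          abs_nonneg (noiseSum f φ n (H (n + 1) ω))]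
      rw [integral_add (integrable_const 1) i2] at h1
      have h2 := hH.integral_noiseSum_sq_le hf hle h0 hφ hC0 hC n
      have h3 : C * (1 - 1 / ((n : ℝ) + 1)) ≤ C :=
        mul_le_of_le_one_right hC0 (sub_le_self _ (by positivity))
      simp only [integral_const, probReal_univ, smul_eq_mul, mul_one] at h1
      linarith
  refine h.mono fun ω hω => ?_
  simpa only [hH.noiseSum_eq] using hω

end IsRegularNetwork

/-! ### Indegree tails and truncated indegree sums -/

/-- The indicator of indegree at least `k`. -/
def tailInd (k z : ℕ) : ℝ := if k ≤ z then 1 else 0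

/-- The excess `(z - k)⁺` of an indegree over `k`. -/
def excess (k z : ℕ) : ℝ := ((z - k : ℕ) : ℝ)

lemma tailInd_nonneg (k z : ℕ) : 0 ≤ tailInd k z := by unfold tailInd; split_ifs <;> norm_num

lemma tailInd_le_one (k z : ℕ) : tailInd k z ≤ 1 := by unfold tailInd; split_ifs <;> norm_num

lemma tailInd_sub (k z : ℕ) : tailInd k z - tailInd (k + 1) z = if z = k then 1 else 0 := by
  unfold tailInd
  split_ifs <;> first | omega | norm_num

lemma tailInd_succ_sub (k z : ℕ) :
    tailInd (k + 1) (z + 1) - tailInd (k + 1) z = if z = k then 1 else 0 := by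
  unfold tailInd
  split_ifs <;> first | omega | norm_num

lemma excess_succ_sub (k z : ℕ) : excess k (z + 1) - excess k z = tailInd k z := by
  unfold excess tailInd
  split_ifs with h
  · rw [Nat.succ_sub h]; push_cast; ring
  · rw [Nat.sub_eq_zero_of_le (by omega : z + 1 ≤ k), Nat.sub_eq_zero_of_le (by omega : z ≤ k)]
    simp

lemma le_excess_add (k z : ℕ) : (z : ℝ) ≤ excess k z + k := by
  unfold excess
  exact_mod_cast (by omega : z ≤ z - k + k)

lemma degDrift_tailInd (f : ℕ → ℝ) (k n : ℕ) (g : Graph) :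
    degDrift f (tailInd (k + 1)) n g =
      f k * (degSum (tailInd k) n g / n - degSum (tailInd (k + 1)) n g / n) := by
  unfold degDrift degSum linkProb
  rw [← sub_div, ← Finset.sum_sub_distrib, Finset.sum_div, Finset.mul_sum]
  refine Finset.sum_congr rfl fun m _ => ?_
  rw [tailInd_succ_sub, tailInd_sub]
  split_ifs with h
  · rw [h]; ring
  · ring

lemma degDrift_excess (f : ℕ → ℝ) (k n : ℕ) (g : Graph) :
    degDrift f (excess k) n g = ∑ m ∈ Finset.Icc 1 n, tailInd k (g.indeg m) * linkProb f n g m :=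
  Finset.sum_congr rfl fun m _ => by rw [excess_succ_sub]

lemma degDrift_excess_le {f : ℕ → ℝ} {η : ℝ} (h0 : 0 < η)
    (hle : ∀ k : ℕ, f k ≤ η * (k : ℝ) + 1) (k n : ℕ) (g : Graph) :
    degDrift f (excess k) n g ≤
      η * (degSum (excess k) n g / n) + (η * k + 1) * (degSum (tailInd k) n g / n) := by
  rw [degDrift_excess, degSum, degSum, Finset.sum_div, Finset.sum_div, Finset.mul_sum,
    Finset.mul_sum, ← Finset.sum_add_distrib]
  refine Finset.sum_le_sum fun m _ => ?_
  rw [linkProb, mul_div_assoc', mul_div_assoc', mul_div_assoc', ← add_div]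
  refine div_le_div_of_nonneg_right ?_ n.cast_nonneg
  have h1 := mul_le_mul_of_nonneg_left (le_excess_add k (g.indeg m)) h0.le
  have h2 := hle (g.indeg m)
  have h3 : 0 ≤ excess k (g.indeg m) := Nat.cast_nonneg _
  unfold tailInd
  split_ifs
  · linarith
  · nlinarith

lemma degSum_nonneg {φ : ℕ → ℝ} (hφ : ∀ z, 0 ≤ φ z) (n : ℕ) (g : Graph) : 0 ≤ degSum φ n g :=
  Finset.sum_nonneg fun _ _ => hφ _

lemma degSum_tailInd_div_le_one (k n : ℕ) (g : Graph) : degSum (tailInd k) n g / n ≤ 1 := by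
  refine div_le_one_of_le₀ ?_ n.cast_nonneg
  calc degSum (tailInd k) n g ≤ ∑ m ∈ Finset.Icc 1 n, (1 : ℝ) :=
        Finset.sum_le_sum fun m _ => tailInd_le_one _ _
    _ = n := by simp

lemma degSum_tailInd_zero (n : ℕ) (g : Graph) : degSum (tailInd 0) n g = n := by
  simp [degSum, tailInd]

/-- The averages of `φ` over the indegrees satisfy a perturbed recursion with step sizes
`1 / (n + 2)`. -/
lemma degSum_div_succ (f φ : ℕ → ℝ) (n : ℕ) (g g' : Graph) :
    degSum φ (n + 1 + 1) g' / ((n + 1 + 1 : ℕ) : ℝ) = degSum φ (n + 1) g / ((n + 1 : ℕ) : ℝ) +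
      (degDrift f φ (n + 1) g - degSum φ (n + 1) g / ((n + 1 : ℕ) : ℝ)) / ((n : ℝ) + 2) +
      degNoise f φ (n + 1) g g' / ((n : ℝ) + 2) := by
  have h : ((n + 1 + 1 : ℕ) : ℝ) = (n : ℝ) + 2 := by push_cast; ring
  rw [h, degNoise]
  push_cast
  field_simp
  ring

lemma empirical_eq (g : Graph) (n k : ℕ) :
    empirical g n k = degSum (tailInd k) n g / n - degSum (tailInd (k + 1)) n g / n := by
  rw [← sub_div, degSum, degSum, ← Finset.sum_sub_distrib, empirical, one_div, div_eq_inv_mul]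
  congr 1
  exact Finset.sum_congr rfl fun m _ => (tailInd_sub _ _).symm

lemma empirical_nonneg (g : Graph) (n k : ℕ) : 0 ≤ empirical g n k :=
  mul_nonneg (by positivity) (Finset.sum_nonneg fun _ _ => by split_ifs <;> norm_num)

lemma hasSum_empirical (g : Graph) {n : ℕ} (hn : 1 ≤ n) : HasSum (empirical g n) 1 := by
  have h : HasSum (fun k => ∑ i ∈ Finset.Icc 1 n, if k = g.indeg i then (1 : ℝ) else 0)
      (∑ i ∈ Finset.Icc 1 n, (1 : ℝ)) := hasSum_sum fun i _ => hasSum_ite_eq (g.indeg i) 1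
  have h2 := h.mul_left (1 / (n : ℝ))
  have hn' : (n : ℝ) ≠ 0 := by positivity
  simp only [Finset.sum_const, Nat.card_Icc, Nat.add_sub_cancel, nsmul_eq_mul, mul_one,
    one_div_mul_cancel hn'] at h2
  have h3 : empirical g n = fun k =>
      1 / (n : ℝ) * ∑ i ∈ Finset.Icc 1 n, if k = g.indeg i then (1 : ℝ) else 0 :=
    funext fun k => congrArg _ (Finset.sum_congr rfl fun i _ => if_congr eq_comm rfl rfl)
  rwa [h3]

/-- Splitting the mean of `f` over the indegrees at indegree `K`. -/
lemma sum_linkProb_eq (f : ℕ → ℝ) (K n : ℕ) (g : Graph) :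
    ∑ m ∈ Finset.Icc 1 n, linkProb f n g m =
      ∑ k ∈ Finset.range K, empirical g n k * f k + degDrift f (excess K) n g := by
  simp only [empirical, degDrift_excess, mul_assoc, Finset.sum_mul, Finset.mul_sum]
  rw [Finset.sum_comm, ← Finset.sum_add_distrib]
  refine Finset.sum_congr rfl fun m _ => ?_
  simp only [ite_mul, one_mul, zero_mul, mul_ite, mul_zero, linkProb, tailInd]
  rw [Finset.sum_ite_eq]
  by_cases h : K ≤ g.indeg m
  · rw [if_neg (by simpa using h), if_pos h, zero_add]
  · rw [if_pos (by simpa using h), if_neg h, add_zero]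
    ring

lemma le_natCast_add_one_of_le {f : ℕ → ℝ} {η : ℝ} (h1 : η < 1)
    (hle : ∀ k : ℕ, f k ≤ η * (k : ℝ) + 1) (k : ℕ) : f k ≤ (k : ℝ) + 1 := by
  have : (0 : ℝ) ≤ k := k.cast_nonneg
  nlinarith [hle k]

lemma linkProb_le {f : ℕ → ℝ} {η : ℝ} (h1 : η < 1)
    (hle : ∀ k : ℕ, f k ≤ η * (k : ℝ) + 1) (K : ℕ) {n m : ℕ} (g : Graph)
    (hm : m ∈ Finset.Icc 1 n) :
    linkProb f n g m ≤ degSum (excess K) n g / n + ((K : ℝ) + 1) / n := by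
  rw [linkProb, ← add_div]
  refine div_le_div_of_nonneg_right ?_ n.cast_nonneg
  have h2 : excess K (g.indeg m) ≤ degSum (excess K) n g :=
    Finset.single_le_sum (f := fun m => excess K (g.indeg m)) (fun _ _ => Nat.cast_nonneg _) hm
  have h3 := le_excess_add K (g.indeg m)
  have h4 := hle (g.indeg m)
  have h5 : (0 : ℝ) ≤ g.indeg m := Nat.cast_nonneg _
  nlinarith

namespace IsRegularNetwork

variable {f : ℕ → ℝ} {P : Measure Ω} {H : ℕ → Ω → Graph}

/-! ### Almost sure convergence of the indegree distribution -/

lemma ae_tendsto_tail [IsProbabilityMeasure P] (hH : IsRegularNetwork f P H)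
    (hf : ∀ k, 0 < f k) (hle : ∀ k : ℕ, f k ≤ (k : ℝ) + 1) :
    ∀ᵐ ω ∂P, ∀ k, Tendsto (fun n => degSum (tailInd k) n (H n ω) / n) atTop
      (𝓝 (limitTail f k)) := by
  have hnoise : ∀ᵐ ω ∂P, ∀ k, ∃ l, Tendsto (fun n => ∑ j ∈ Finset.range n,
      degNoise f (tailInd (k + 1)) (j + 1) (H (j + 1) ω) (H (j + 1 + 1) ω) / ((j : ℝ) + 2))
      atTop (𝓝 l) := by
    refine ae_all_iff.2 fun k => hH.ae_tendsto_noiseSum hf hle (by simp [tailInd]) (fun z => ?_)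
      (hf k).le fun n _ => ?_
    · rw [tailInd_succ_sub]
      split_ifs <;> norm_num
    · have h : ∫ ω, degDrift f (tailInd (k + 1)) n (H n ω) ∂P ≤ ∫ _, f k ∂P := by
        refine integral_mono (hH.integrable_comp' n _) (integrable_const _) fun ω => ?_
        simp only [degDrift_tailInd]
        have h1 := degSum_tailInd_div_le_one k n (H n ω)
        have h2 : 0 ≤ degSum (tailInd (k + 1)) n (H n ω) / n :=
          div_nonneg (degSum_nonneg (tailInd_nonneg _) _ _) n.cast_nonneg
        exact mul_le_of_le_one_right (hf k).le (by linarith)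
      simpa using h
  filter_upwards [hnoise] with ω hω k
  induction k with
  | zero =>
    rw [limitTail_zero]
    refine tendsto_const_nhds.congr' ?_
    filter_upwards [eventually_ge_atTop 1] with n hn
    rw [degSum_tailInd_zero, div_self (by positivity)]
  | succ k ih =>
    rw [← tendsto_add_atTop_iff_nat 1] at ih ⊢
    have h := tendsto_of_recursion
      (x := fun n : ℕ => degSum (tailInd (k + 1)) (n + 1) (H (n + 1) ω) / ((n + 1 : ℕ) : ℝ))
      (c := 1 + f k) (by linarith [hf k]) (fun n => ?_) (hω k) (ih.const_mul (f k))
    · rwa [limitTail_succ, mul_div_assoc', mul_comm (limitTail f k)]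
    · rw [degSum_div_succ f (tailInd (k + 1)) n (H (n + 1) ω), degDrift_tailInd]
      congr 3
      ring

lemma ae_tendsto_empirical [IsProbabilityMeasure P] (hH : IsRegularNetwork f P H)
    (hf : ∀ k, 0 < f k) (hle : ∀ k : ℕ, f k ≤ (k : ℝ) + 1) :
    ∀ᵐ ω ∂P, ∀ k, Tendsto (fun n => empirical (H n ω) n k) atTop (𝓝 (limitWeight f k)) := by
  filter_upwards [hH.ae_tendsto_tail hf hle] with ω hω k
  rw [limitWeight_eq_sub hf]
  simpa only [empirical_eq] using (hω k).sub (hω (k + 1))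

/-! ### Uniform control of the large indegrees -/

lemma integral_excess_le [IsProbabilityMeasure P] (hH : IsRegularNetwork f P H)
    (hf : ∀ k, 0 < f k) {η : ℝ} (h0 : 0 < η) (h1 : η < 1)
    (hle : ∀ k : ℕ, f k ≤ η * (k : ℝ) + 1) (K : ℕ) {n : ℕ} (hn : 1 ≤ n) :
    ∫ ω, degSum (excess K) n (H n ω) ∂P ≤ (η * K + 1) / (1 - η) * n ∧
      ∫ ω, degDrift f (excess K) n (H n ω) ∂P ≤ (η * K + 1) / (1 - η) := by
  have hle' := le_natCast_add_one_of_le h1 hle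
  have h1' : 0 < 1 - η := by linarith
  have hdrift : ∀ n : ℕ, 1 ≤ n →
      ∫ ω, degSum (excess K) n (H n ω) ∂P ≤ (η * K + 1) / (1 - η) * n →
      ∫ ω, degDrift f (excess K) n (H n ω) ∂P ≤ (η * K + 1) / (1 - η) := by
    intro n hn h
    have hn' : (0 : ℝ) < n := by exact_mod_cast hn
    have i1 : Integrable (fun ω => η / n * degSum (excess K) n (H n ω) + (η * K + 1)) P :=
      ((hH.integrable_comp' n (degSum (excess K) n)).const_mul _).add (integrable_const _)
    have h2 : ∫ ω, degDrift f (excess K) n (H n ω) ∂P ≤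
        ∫ ω, (η / n * degSum (excess K) n (H n ω) + (η * K + 1)) ∂P := by
      refine integral_mono (hH.integrable_comp' n _) i1 fun ω => ?_
      refine (degDrift_excess_le h0 hle K n _).trans (add_le_add (le_of_eq (by ring)) ?_)
      exact mul_le_of_le_one_right (by positivity) (degSum_tailInd_div_le_one K n _)
    rw [integral_add ((hH.integrable_comp' n (degSum (excess K) n)).const_mul _)
      (integrable_const _), integral_const_mul] at h2
    simp only [integral_const, probReal_univ, smul_eq_mul, one_mul] at h2
    refine h2.trans ?_
    calc η / n * ∫ ω, degSum (excess K) n (H n ω) ∂P + (η * K + 1)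
        ≤ η / n * ((η * K + 1) / (1 - η) * n) + (η * K + 1) := by gcongr
      _ = (η * K + 1) / (1 - η) := by field_simp; ring
  have hsum : ∫ ω, degSum (excess K) n (H n ω) ∂P ≤ (η * K + 1) / (1 - η) * n := by
    induction n, hn using Nat.le_induction with
    | base =>
      have h2 : ∀ ω, degSum (excess K) 1 (H 1 ω) = 0 := fun ω => by
        have := (hH.isRecursive 1 ω).indeg_succ_le (m := 1) (by simp)
        simp only [degSum, Finset.Icc_self, Finset.sum_singleton, excess]
        exact_mod_cast (by omega : (H 1 ω).indeg 1 - K = 0)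
      simp only [h2, integral_zero]
      positivity
    | succ n hn ih =>
      rw [hH.integral_degSum_succ hf hle' (by simp [excess]) hn]
      have := hdrift n hn ih
      push_cast
      linarith
  exact ⟨hsum, hdrift n hn hsum⟩

/-- Almost surely, the mean excess of the indegrees over `K` has upper limit at most
`(η K + 1) q K / (1 - η)`. -/
lemma ae_eventually_excess_le [IsProbabilityMeasure P] (hH : IsRegularNetwork f P H)
    (hf : ∀ k, 0 < f k) {η : ℝ} (h0 : 0 < η) (h1 : η < 1)
    (hle : ∀ k : ℕ, f k ≤ η * (k : ℝ) + 1) :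
    ∀ᵐ ω ∂P, ∀ K : ℕ, ∀ δ > 0, ∀ᶠ n in atTop, degSum (excess K) n (H n ω) / n ≤
      (η * K + 1) * limitTail f K / (1 - η) + δ := by
  have hle' := le_natCast_add_one_of_le h1 hle
  have h1' : 0 < 1 - η := by linarith
  have hnoise : ∀ᵐ ω ∂P, ∀ K, ∃ l, Tendsto (fun n => ∑ j ∈ Finset.range n,
      degNoise f (excess K) (j + 1) (H (j + 1) ω) (H (j + 1 + 1) ω) / ((j : ℝ) + 2))
      atTop (𝓝 l) := by
    refine ae_all_iff.2 fun K => hH.ae_tendsto_noiseSum hf hle' (by simp [excess]) (fun z => ?_)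
      (C := (η * K + 1) / (1 - η)) (by positivity)
      fun n hn => (hH.integral_excess_le hf h0 h1 hle K hn).2
    rw [excess_succ_sub]
    exact ⟨tailInd_nonneg _ _, tailInd_le_one _ _⟩
  filter_upwards [hnoise, hH.ae_tendsto_tail hf hle'] with ω hω htail K δ hδ
  have ht := (((tendsto_add_atTop_iff_nat 1).2 (htail K)).const_mul (η * K + 1))
  have h := eventually_le_of_recursion
    (x := fun n : ℕ => degSum (excess K) (n + 1) (H (n + 1) ω) / ((n + 1 : ℕ) : ℝ))
    (a := fun n : ℕ => (η * K + 1) *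
      (degSum (tailInd K) (n + 1) (H (n + 1) ω) / ((n + 1 : ℕ) : ℝ)))
    (α := (η * K + 1) * limitTail f K) h1' (fun n => ?_) (hω K)
    (fun ε hε => (ht.eventually_lt_const (lt_add_of_pos_right _ hε)).mono fun n hn => hn.le) hδ
  · rwa [← map_add_atTop_eq_nat 1, eventually_map]
  · rw [degSum_div_succ f (excess K) n (H (n + 1) ω)]
    have h2 := degDrift_excess_le h0 hle K (n + 1) (H (n + 1) ω)
    have h3 := div_le_div_of_nonneg_right (show degDrift f (excess K) (n + 1) (H (n + 1) ω) -
        degSum (excess K) (n + 1) (H (n + 1) ω) / ((n + 1 : ℕ) : ℝ) ≤ (η * K + 1) *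
        (degSum (tailInd K) (n + 1) (H (n + 1) ω) / ((n + 1 : ℕ) : ℝ)) - (1 - η) *
        (degSum (excess K) (n + 1) (H (n + 1) ω) / ((n + 1 : ℕ) : ℝ)) by linarith)
      (show (0 : ℝ) ≤ (n : ℝ) + 2 by positivity)
    linarith

/-- The mean of `f` over the indegrees converges to `⟨μ, f⟩ = ∑ q (k + 1)`. -/
lemma ae_tendsto_sum_linkProb [IsProbabilityMeasure P] (hH : IsRegularNetwork f P H)
    (hf : ∀ k, 0 < f k) {η : ℝ} (h0 : 0 < η) (h1 : η < 1)
    (hle : ∀ k : ℕ, f k ≤ η * (k : ℝ) + 1) :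
    ∀ᵐ ω ∂P, Tendsto (fun n => ∑ m ∈ Finset.Icc 1 n, linkProb f n (H n ω) m) atTop
      (𝓝 (∑' k, limitTail f (k + 1))) := by
  have hle' := le_natCast_add_one_of_le h1 hle
  have h1' : 0 < 1 - η := by linarith
  filter_upwards [hH.ae_eventually_excess_le hf h0 h1 hle, hH.ae_tendsto_tail hf hle',
    hH.ae_tendsto_empirical hf hle'] with ω hexc htail hemp
  rw [Metric.tendsto_nhds]
  intro ε hε
  -- The limiting contribution of the indegrees `≥ K` is at most `R K`.
  set R : ℕ → ℝ := fun K => (η * K + 1) * limitTail f K / (1 - η) with hR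
  have hR0 : Tendsto R atTop (𝓝 0) := by
    simpa using (tendsto_mul_limitTail hf h0 h1 hle).div_const (1 - η)
  have hS := (summable_limitTail hf h0 h1 hle).hasSum.tendsto_sum_nat
  obtain ⟨K, hK1, hK2⟩ := ((hR0.eventually_lt_const (show (0 : ℝ) < ε / 8 by positivity)).and
    (Metric.tendsto_nhds.1 hS (ε / 4) (by positivity))).exists
  have hlow : Tendsto (fun n => ∑ k ∈ Finset.range K, empirical (H n ω) n k * f k) atTop
      (𝓝 (∑ k ∈ Finset.range K, limitTail f (k + 1))) := by
    have := tendsto_finsetSum (Finset.range K) fun k _ => (hemp k).mul_const (f k)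
    simpa only [limitWeight_mul] using this
  have hKt : (η * K + 1) * limitTail f K ≤ R K := by
    rw [hR, le_div_iff₀ h1']
    have := limitTail_pos hf K
    exact mul_le_of_le_one_right (by positivity) (by linarith)
  filter_upwards [Metric.tendsto_nhds.1 hlow (ε / 4) (by positivity),
    hexc K (ε / 8) (by positivity),
    ((htail K).const_mul (η * K + 1)).eventually_lt_const
      (show (η * K + 1) * limitTail f K < (η * K + 1) * limitTail f K + ε / 8 by linarith)]
    with n hn1 hn2 hn3
  rw [Real.dist_eq] at hn1 hK2 ⊢
  have h2 := degDrift_excess_le h0 hle K n (H n ω)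
  have h3 : 0 ≤ degDrift f (excess K) n (H n ω) := by
    rw [degDrift_excess]
    exact Finset.sum_nonneg fun m hm => mul_nonneg (tailInd_nonneg _ _)
      (linkProb_mem hf hle' (hH.isRecursive n ω) hm).1
  have h4 : 0 ≤ degSum (excess K) n (H n ω) / n :=
    div_nonneg (degSum_nonneg (fun _ => Nat.cast_nonneg _) _ _) n.cast_nonneg
  have h5 : η * (degSum (excess K) n (H n ω) / n) ≤ degSum (excess K) n (H n ω) / n :=
    mul_le_of_le_one_left h4 h1.le
  have h6 : (η * K + 1) * limitTail f K / (1 - η) = R K := rfl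
  rw [sum_linkProb_eq f K]
  rw [abs_lt] at hn1 hK2 ⊢
  constructor <;> linarith

lemma ae_tendsto_sum_linkProb_sq [IsProbabilityMeasure P] (hH : IsRegularNetwork f P H)
    (hf : ∀ k, 0 < f k) {η : ℝ} (h0 : 0 < η) (h1 : η < 1)
    (hle : ∀ k : ℕ, f k ≤ η * (k : ℝ) + 1) :
    ∀ᵐ ω ∂P, Tendsto (fun n => ∑ m ∈ Finset.Icc 1 n, linkProb f n (H n ω) m ^ 2) atTop
      (𝓝 0) := by
  have hle' := le_natCast_add_one_of_le h1 hle
  filter_upwards [hH.ae_eventually_excess_le hf h0 h1 hle,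
    hH.ae_tendsto_sum_linkProb hf h0 h1 hle] with ω hexc hsum
  have hp : ∀ n, ∀ m ∈ Finset.Icc 1 n, 0 ≤ linkProb f n (H n ω) m := fun n m hm =>
    (linkProb_mem hf hle' (hH.isRecursive n ω) hm).1
  have hmax : ∀ ε > 0, ∀ᶠ n in atTop, ∀ m ∈ Finset.Icc 1 n, linkProb f n (H n ω) m ≤ ε := by
    intro ε hε
    have hR0 := (tendsto_mul_limitTail hf h0 h1 hle).div_const (1 - η)
    rw [zero_div] at hR0
    obtain ⟨K, hK⟩ := (hR0.eventually_lt_const (show (0 : ℝ) < ε / 3 by positivity)).exists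
    filter_upwards [hexc K (ε / 3) (by positivity),
      (tendsto_const_div_atTop_nhds_zero_nat ((K : ℝ) + 1)).eventually_lt_const
        (show (0 : ℝ) < ε / 3 by positivity)] with n h2 h3 m hm
    have := linkProb_le h1 hle K (H n ω) hm
    linarith
  set L := ∑' k, limitTail f (k + 1) with hL
  have hL0 : 0 ≤ L := tsum_nonneg fun k => (limitTail_pos hf _).le
  rw [Metric.tendsto_nhds]
  intro ε hε
  filter_upwards [hmax (ε / (2 * (L + 1))) (by positivity),
    hsum.eventually_lt_const (show L < L + 1 by linarith)] with n h2 h3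
  rw [Real.dist_eq, sub_zero, abs_of_nonneg (Finset.sum_nonneg fun m _ => sq_nonneg _)]
  calc ∑ m ∈ Finset.Icc 1 n, linkProb f n (H n ω) m ^ 2
      ≤ ∑ m ∈ Finset.Icc 1 n, ε / (2 * (L + 1)) * linkProb f n (H n ω) m :=
        Finset.sum_le_sum fun m hm => by
          rw [sq]
          exact mul_le_mul_of_nonneg_right (h2 m hm) (hp n m hm)
    _ ≤ ε / (2 * (L + 1)) * (L + 1) := by
        rw [← Finset.mul_sum]
        gcongr
    _ = ε / 2 := by field_simp
    _ < ε := half_lt_self hε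

/-! ### The conditional distribution of the outdegree -/

lemma ae_condOutdeg_eq [IsProbabilityMeasure P] (hH : IsRegularNetwork f P H)
    (hf : ∀ k, 0 < f k) (hle : ∀ k : ℕ, f k ≤ (k : ℝ) + 1) {n : ℕ} (hn : 1 ≤ n) :
    ∀ᵐ ω ∂P, ∀ k, (condOutdeg P H n ω).real {k} =
      bernCount (Finset.Icc 1 n) (linkProb f n (H n ω)) k := by
  -- Almost surely, the conditioning event is an atom.
  have hatom : ∀ᵐ ω ∂P, P {ω' | H n ω' = H n ω} ≠ 0 := by
    have h : ∀ᵐ ω ∂P, ∀ g : Graph, P {ω' | H n ω' = g} = 0 → H n ω ≠ g := by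
      rw [ae_all_iff]
      intro g
      by_cases hg : P {ω' | H n ω' = g} = 0
      · have : ∀ᵐ ω ∂P, H n ω ≠ g := by rw [ae_iff]; simpa using hg
        exact this.mono fun ω h _ => h
      · exact Eventually.of_forall fun ω h => absurd h hg
    exact h.mono fun ω hω h0 => hω _ h0 rfl
  filter_upwards [hatom] with ω hω k
  set g := H n ω with hgdef
  have hg : g.IsRecursive n := hH.isRecursive n ω
  have hYm : Measurable fun ω' => (H (n + 1) ω').outdeg (n + 1) :=
    (Measurable.of_discrete (f := fun g' : Graph => g'.outdeg (n + 1))).comp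
      (hH.measurable (n + 1))
  have hmap : P.map (H n) {g} = P {ω' | H n ω' = g} :=
    Measure.map_apply (hH.measurable n) (measurableSet_singleton g)
  have hjoint : P.map (fun ω' => (H n ω', (H (n + 1) ω').outdeg (n + 1))) ({g} ×ˢ {k}) =
      P ({ω' | H n ω' = g} ∩ {ω' | (H (n + 1) ω').outdeg (n + 1) = k}) := by
    rw [Measure.map_apply ((hH.measurable n).prodMk hYm)
      ((measurableSet_singleton g).prod (measurableSet_singleton k))]
    rfl
  have hstep := hH.setIntegral_step hf hle hn hg
    fun g' => if g'.outdeg (n + 1) = k then (1 : ℝ) else 0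
  have hint : ∫ ω' in {ω' | H n ω' = g},
      (if (H (n + 1) ω').outdeg (n + 1) = k then (1 : ℝ) else 0) ∂P =
      P.real ({ω' | H n ω' = g} ∩ {ω' | (H (n + 1) ω').outdeg (n + 1) = k}) := by
    have hkm : MeasurableSet {ω' | (H (n + 1) ω').outdeg (n + 1) = k} :=
      measurableSet_eq_fun hYm measurable_const
    have h := integral_indicator_one (μ := P.restrict {ω' | H n ω' = g}) hkm
    rw [measureReal_restrict_apply hkm, Set.inter_comm] at h
    rw [← h]
    congr 1
    funext ω'
    simp [Set.indicator_apply]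
  have hbern : bernSum (Finset.Icc 1 n) (linkProb f n g)
      (fun A => if (g.attach (n + 1) A).outdeg (n + 1) = k then (1 : ℝ) else 0) =
      bernCount (Finset.Icc 1 n) (linkProb f n g) k := by
    simp only [hg.outdeg_attach, bernCount]
  have hω' : P.real {ω' | H n ω' = g} ≠ 0 := by
    rw [measureReal_def]
    exact ENNReal.toReal_ne_zero.2 ⟨hω, measure_ne_top _ _⟩
  rw [hint, hbern] at hstep
  rw [measureReal_def, condOutdeg, ← hgdef,
    condDistrib_apply_of_ne_zero hYm g (by rwa [hmap]) {k}, hmap, hjoint, ENNReal.toReal_mul,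
    ENNReal.toReal_inv, ← measureReal_def, ← measureReal_def, hstep, ← mul_assoc,
    inv_mul_cancel₀ hω', one_mul]

end IsRegularNetwork

end PrefAttach

open PrefAttach

theorem mainTheorem5 {Ω : Type*} [MeasurableSpace Ω] (P : Measure Ω) [IsProbabilityMeasure P]
    (f : ℕ → ℝ) (hf_mono : Monotone f) (hf_pos : ∀ k, 0 < f k)
    (hf_le : ∀ k : ℕ, f k ≤ (k : ℝ) + 1)
    (G : ℕ → Ω → PrefAttach.Graph) (hG : PrefAttach.IsNetwork f P G) :
    ((∀ k, 0 ≤ PrefAttach.limitWeight f k) ∧ HasSum (PrefAttach.limitWeight f) 1 ∧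
      ∀ᵐ ω ∂P, Tendsto
        (fun n => PrefAttach.tvNorm
          (fun k => PrefAttach.empirical (G n ω) n k - PrefAttach.limitWeight f k))
        atTop (𝓝 0)) ∧
    (∀ η : ℝ, 0 < η → η < 1 → (∀ k : ℕ, f k ≤ η * (k : ℝ) + 1) →
      ∃ r : ℝ≥0, HasSum (fun k => PrefAttach.limitWeight f k * f k) (r : ℝ) ∧
        ∀ᵐ ω ∂P, Tendsto
          (fun n => PrefAttach.tvDist (PrefAttach.condOutdeg P G n ω) (poissonMeasure r))
          atTop (𝓝 0)) := by
  obtain ⟨H, hH, hGH⟩ := hG.exists_isRegularNetwork hf_pos hf_le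
  refine ⟨⟨limitWeight_nonneg hf_pos, hasSum_limitWeight hf_pos hf_le, ?_⟩, ?_⟩
  · filter_upwards [hGH, hH.ae_tendsto_empirical hf_pos hf_le] with ω hω hlim
    have h := tendsto_tvNorm_of_tendsto (Eventually.of_forall fun n => empirical_nonneg (H n ω) n)
      ((eventually_ge_atTop 1).mono fun n hn => hasSum_empirical (H n ω) hn)
      (hasSum_limitWeight hf_pos hf_le) hlim
    refine h.congr' ?_
    filter_upwards [eventually_ge_atTop 1] with n hn
    rw [hω n hn]
  · intro η h0 h1 hle
    have hL0 : 0 ≤ ∑' k, limitTail f (k + 1) := tsum_nonneg fun k => (limitTail_pos hf_pos _).le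
    obtain ⟨r, hr⟩ : ∃ r : ℝ≥0, (r : ℝ) = ∑' k, limitTail f (k + 1) :=
      ⟨Real.toNNReal _, Real.coe_toNNReal _ hL0⟩
    refine ⟨r, ?_, ?_⟩
    · simpa only [limitWeight_mul, hr] using (summable_limitTail hf_pos h0 h1 hle).hasSum
    · have hcond : ∀ᵐ ω ∂P, ∀ n, 1 ≤ n → ∀ k, (condOutdeg P H n ω).real {k} =
          bernCount (Finset.Icc 1 n) (linkProb f n (H n ω)) k := ae_all_iff.2 fun n => by
        by_cases hn : 1 ≤ n
        · exact (hH.ae_condOutdeg_eq hf_pos hf_le hn).mono fun ω h _ => h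
        · exact Eventually.of_forall fun ω h => absurd h hn
      filter_upwards [hGH, hcond, hH.ae_tendsto_sum_linkProb hf_pos h0 h1 hle,
        hH.ae_tendsto_sum_linkProb_sq hf_pos h0 h1 hle] with ω hω hc hsum hsq
      have hp : ∀ n, ∀ m ∈ Finset.Icc 1 n, 0 ≤ linkProb f n (H n ω) m ∧
          linkProb f n (H n ω) m ≤ 1 := fun n m hm =>
        linkProb_mem hf_pos hf_le (hH.isRecursive n ω) hm
      have h := tendsto_tvNorm_of_tendsto
        (a := fun n => bernCount (Finset.Icc 1 n) (linkProb f n (H n ω)))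
        (Eventually.of_forall fun n => bernCount_nonneg (hp n))
        (Eventually.of_forall fun n => hasSum_bernCount _ _)
        (hasSum_one_poissonMeasure r)
        (fun k => tendsto_bernCount (Eventually.of_forall hp) (hr ▸ hsum) hsq k)
      refine h.congr' ?_
      filter_upwards [eventually_ge_atTop 1] with n hn
      have hGn : G n =ᵐ[P] H n := hGH.mono fun ω' h' => h' n hn
      have hYn : (fun ω' => (G (n + 1) ω').outdeg (n + 1)) =ᵐ[P]
          fun ω' => (H (n + 1) ω').outdeg (n + 1) :=
        hGH.mono fun ω' h' => by simp only [h' (n + 1) (by omega)]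
      have hGc : condOutdeg P G n ω = condOutdeg P H n ω := by
        rw [condOutdeg, condOutdeg, condDistrib_congr hYn hGn, hω n hn]
      rw [tvDist, hGc]
      congr 1
      funext k
      rw [hc n hn k, poissonMeasure_real_singleton]
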